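/- **Theorem (burn-in).** Let $G\subseteq\mathbb{R}^d$ with its Borel $\sigma$-algebra $\mathcal{B}(G)$, let $K$ be a transition kernel on $(G,\mathcal{B}(G))$ that is reversible with respect to a probability measure $\pi$, and let $\nu$ be a probability measure on $(G,\mathcal{B}(G))$ that has a density $\frac{d\nu}{d\pi}\in L_2=L_2(\pi)$. Write $\|\cdot\|_2$ for the norm of $L_2(\pi)$, $Pf(x)=\int_G f(y)\,K(x,dy)$ for the Markov operator on $L_2$, $\nu P(A)=\int_G K(x,A)\,\nu(dx)$, $L_2^0=\{f\in L_2:\int_G f\,d\pi=0\}$, and $$\Lambda=\sup\{\lambda\in\mathrm{spec}(P\mid L_2^0)\},\qquad \Lambda_0=\max\{0,\Lambda\},\qquad \beta=\|P\|_{L_2^0\to L_2^0},$$ where $\Lambda:=0$ if $L_2^0=\{0\}$. Assume that $P$ is variance bounding, i.e. $\Lambda<1$. Let $\mathscr{A}\subseteq\mathcal{B}(G)$ be a set of test sets and for every $\delta>0$ let $\Gamma_\delta\subseteq\mathcal{B}(G)$ be a finite $\delta$-cover of $\mathscr{A}$ with respect to $\pi$: $\emptyset\in\Gamma_\delta$,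 and for every $A\in\mathscr{A}$ there are $C,D\in\Gamma_\delta$ with $C\subseteq A\subseteq D$ and $\pi(D\setminus C)\le\delta$. Let $\varphi\colon G\times[0,1]^s\to G$ be an update function of $K$, i.e. $\varphi$ is measurable and $K(x,A)=\lambda_s(\{u\in[0,1]^s:\varphi(x;u)\in A\})$ for all $x\in G$, $A\in\mathcal{B}(G)$, and let $\psi\colon[0,1]^s\to G$ be a generator function of $\nu$, i.e. $\psi$ is measurable and $\nu(A)=\lambda_s(\{u\in[0,1]^s:\psi(u)\in A\})$ for all $A\in\mathcal{B}(G)$; here $\lambda_k$ is Lebesgue measure on $\mathbb{R}^k$. For points $u_0,u_1,\dots\in[0,1]^s$ put $x_1=\psi(u_0)$ and $x_{i+1}=\varphi(x_i;u_i)$ for $i\ge1$, and for $i\ge 0$ let $C_{i,\psi}(A)\subseteq[0,1]^{(i+1)s}$ be the set of all $(u_0,\dots,u_i)$ for which $x_{i+1}\in A$. For $n_0\ge0$, $n\ge1$ and $\mathcal{U}_{n_0,n}=\{u_0,\dots,u_{n_0+n-1}\}$, $S_{[n_0,n]}=\{x_{n_0+1},\dots,x_{n_0+n}\}$ (finite sequences)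 define $$D^\ast_{\mathscr{A},\pi}(S_{[n_0,n]})=\sup_{A\in\mathscr{A}}\left|\frac1n\sum_{i=n_0+1}^{n_0+n}1_{x_i\in A}-\pi(A)\right|,$$ $$D^\ast_{n_0,\mathscr{A},\psi,\varphi}(\mathcal{U}_{n_0,n})=\sup_{A\in\mathscr{A}}\left|\frac1n\sum_{i=n_0}^{n_0+n-1}\left[1_{(u_0,\dots,u_i)\in C_{i,\psi}(A)}-\lambda_{(i+1)s}(C_{i,\psi}(A))\right]\right|.$$ Then, for all $n_0\ge0$, $n\ge1$ and $\delta>0$, the measure $\nu P^{n_0}$ has a density with respect to $\pi$ in $L_2$, and there exists a driver sequence $\mathcal{U}_{n_0,n}=\{u_0,\dots,u_{n_0+n-1}\}\subset[0,1]^s$ such that $$D^\ast_{\mathscr{A},\pi}(S_{[n_0,n]})\le\sqrt{\frac{1+\Lambda_0}{1-\Lambda_0}}\cdot\frac{\sqrt{2\log\left(|\Gamma_\delta|^2\left\|\frac{d(\nu P^{n_0})}{d\pi}\right\|_2\right)}}{\sqrt n}+\delta .$$ If moreover $P$ has an absolute $L_2$-spectral gap, i.e. $\beta<1$, then $\Lambda\le\Lambda_0\le\beta$,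 $|\Lambda|\le\beta$, and the same driver sequence satisfies $$D^\ast_{n_0,\mathscr{A},\psi,\varphi}(\mathcal{U}_{n_0,n})\le\sqrt{\frac{1+\Lambda_0}{1-\Lambda_0}}\cdot\frac{\sqrt{2\log\left(|\Gamma_\delta|^2\left(1+\beta^{n_0}\left\|\frac{d\nu}{d\pi}-1\right\|_2\right)\right)}}{\sqrt n}+\frac{(1-\Lambda_0^n)\,\beta^{n_0}}{n(1-\Lambda_0)}\left\|\frac{d\nu}{d\pi}-1\right\|_2+\delta$$ and in particular $$D^\ast_{n_0,\mathscr{A},\psi,\varphi}(\mathcal{U}_{n_0,n})\le\frac{4\sqrt{\log\left(|\Gamma_\delta|^2\left(1+\beta^{n_0}\left\|\frac{d\nu}{d\pi}-1\right\|_2\right)\right)}}{\sqrt{n(1-\beta)}}+\frac{2\beta^{n_0}\left\|\frac{d\nu}{d\pi}-1\right\|_2}{n(1-\beta)}+\delta .$$ -/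

import Mathlib

open MeasureTheory ProbabilityTheory
open scoped ENNReal

noncomputable section

namespace MCQMC

section MarkovOperator

variable {X : Type*} [MeasurableSpace X]

lemma ae_integrable_kernel {K : Kernel X X} [IsMarkovKernel K] {π : Measure X}
    [IsProbabilityMeasure π] (hK : K.Invariant π) (f : Lp ℝ 2 π) :
    ∀ᵐ x ∂π, Integrable f (K x) := by
  have hf : Integrable f (π.bind K) := by
    rw [hK.def]; exact (Lp.memLp f).integrable (by norm_num)
  exact ((Measure.integrable_comp_iff hf.1).1 hf).1

lemma memLp_integral_kernel {K : Kernel X X} [IsMarkovKernel K] {π : Measure X}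
    [IsProbabilityMeasure π] (hK : K.Invariant π) (f : Lp ℝ 2 π) :
    MemLp (fun x => ∫ y, f y ∂K x) 2 π ∧
      eLpNorm (fun x => ∫ y, f y ∂K x) 2 π ≤ eLpNorm f 2 π := by
  have hfm : StronglyMeasurable (f : X → ℝ) := Lp.stronglyMeasurable f
  have hle : eLpNorm (fun x => ∫ y, f y ∂K x) 2 π ≤ eLpNorm f 2 π := by
    have h1 : ∀ x, ‖∫ y, f y ∂K x‖ₑ ^ (2 : ℝ) ≤ ∫⁻ y, ‖f y‖ₑ ^ (2 : ℝ) ∂K x := by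
      intro x
      have h2 : ‖∫ y, f y ∂K x‖ₑ ≤ eLpNorm f 2 (K x) := by
        refine (enorm_integral_le_lintegral_enorm _).trans ?_
        rw [← eLpNorm_one_eq_lintegral_enorm]
        exact eLpNorm_le_eLpNorm_of_exponent_le (by norm_num) hfm.aestronglyMeasurable
      calc ‖∫ y, f y ∂K x‖ₑ ^ (2 : ℝ) ≤ (eLpNorm f 2 (K x)) ^ (2 : ℝ) := by gcongr
        _ = ∫⁻ y, ‖f y‖ₑ ^ (2 : ℝ) ∂K x := by
          rw [eLpNorm_eq_lintegral_rpow_enorm_toReal (by norm_num) (by norm_num)]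
          rw [← ENNReal.rpow_mul]
          norm_num
    rw [eLpNorm_eq_lintegral_rpow_enorm_toReal (by norm_num) (by norm_num),
      eLpNorm_eq_lintegral_rpow_enorm_toReal (by norm_num) (by norm_num)]
    simp only [ENNReal.toReal_ofNat]
    refine ENNReal.rpow_le_rpow ?_ (by norm_num)
    calc ∫⁻ x, ‖∫ y, f y ∂K x‖ₑ ^ (2 : ℝ) ∂π
        ≤ ∫⁻ x, ∫⁻ y, ‖f y‖ₑ ^ (2 : ℝ) ∂K x ∂π := lintegral_mono h1
      _ = ∫⁻ y, ‖f y‖ₑ ^ (2 : ℝ) ∂(π.bind K) :=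
          (Measure.lintegral_bind (Kernel.aemeasurable _)
            (hfm.measurable.enorm.pow_const _).aemeasurable).symm
      _ = ∫⁻ y, ‖f y‖ₑ ^ (2 : ℝ) ∂π := by rw [hK.def]
  exact ⟨⟨(hfm.integral_kernel).aestronglyMeasurable, hle.trans_lt (Lp.eLpNorm_lt_top f)⟩, hle⟩

/-- The Markov operator `P : L₂(π) → L₂(π)`, `(P f)(x) = ∫ f(y) K(x, dy)`, of a transition
kernel `K` with stationary distribution `π`. -/
def markovOp (K : Kernel X X) [IsMarkovKernel K] (π : Measure X) [IsProbabilityMeasure π]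
    (hK : K.Invariant π) : Lp ℝ 2 π →L[ℝ] Lp ℝ 2 π :=
  LinearMap.mkContinuous
    { toFun := fun f => (memLp_integral_kernel hK f).1.toLp (fun x => ∫ y, f y ∂K x)
      map_add' := by
        intro f g
        rw [← MemLp.toLp_add, MemLp.toLp_eq_toLp_iff]
        have hfg : ∀ᵐ y ∂(π.bind K), (f + g : Lp ℝ 2 π) y = f y + g y := by
          rw [hK.def]; exact Lp.coeFn_add f g
        filter_upwards [Measure.ae_ae_of_ae_comp hfg, ae_integrable_kernel hK f,
          ae_integrable_kernel hK g] with x hx hf hg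
        rw [integral_congr_ae hx, Pi.add_apply, integral_add hf hg]
      map_smul' := by
        intro c f
        rw [RingHom.id_apply, ← MemLp.toLp_const_smul, MemLp.toLp_eq_toLp_iff]
        have hcf : ∀ᵐ y ∂(π.bind K), (c • f : Lp ℝ 2 π) y = c • f y := by
          rw [hK.def]; exact Lp.coeFn_smul c f
        filter_upwards [Measure.ae_ae_of_ae_comp hcf] with x hx
        rw [integral_congr_ae hx, Pi.smul_apply, integral_smul] }
    1 (by
      intro f
      rw [one_mul, Lp.norm_def f]
      simp only [LinearMap.coe_mk, AddHom.coe_mk]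
      rw [Lp.norm_toLp]
      exact ENNReal.toReal_mono (Lp.eLpNorm_ne_top f) (memLp_integral_kernel hK f).2)

lemma markovOp_coeFn (K : Kernel X X) [IsMarkovKernel K] (π : Measure X)
    [IsProbabilityMeasure π] (hK : K.Invariant π) (f : Lp ℝ 2 π) :
    markovOp K π hK f =ᵐ[π] fun x => ∫ y, f y ∂K x :=
  MemLp.coeFn_toLp (memLp_integral_kernel hK f).1

/-- The subspace `L₂⁰(π)` of all `f ∈ L₂(π)` with `∫ f dπ = 0`. -/
def L20 (π : Measure X) [IsProbabilityMeasure π] : Submodule ℝ (Lp ℝ 2 π) where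
  carrier := {f | ∫ x, f x ∂π = 0}
  zero_mem' := by
    change ∫ x, (0 : Lp ℝ 2 π) x ∂π = 0
    rw [integral_congr_ae (Lp.coeFn_zero ℝ 2 π)]
    simp
  add_mem' := by
    intro f g hf hg
    change ∫ x, (f + g : Lp ℝ 2 π) x ∂π = 0
    rw [integral_congr_ae (Lp.coeFn_add f g)]
    simp only [Pi.add_apply]
    rw [integral_add ((Lp.memLp f).integrable (by norm_num))
      ((Lp.memLp g).integrable (by norm_num)), hf, hg, add_zero]
  smul_mem' := by
    intro c f hf
    change ∫ x, (c • f : Lp ℝ 2 π) x ∂π = 0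
    rw [integral_congr_ae (Lp.coeFn_smul c f)]
    simp only [Pi.smul_apply]
    rw [integral_smul, hf, smul_zero]

lemma markovOp_mem_L20 (K : Kernel X X) [IsMarkovKernel K] (π : Measure X)
    [IsProbabilityMeasure π] (hK : K.Invariant π) (f : Lp ℝ 2 π) (hf : f ∈ L20 π) :
    markovOp K π hK f ∈ L20 π := by
  change ∫ x, markovOp K π hK f x ∂π = 0
  have hint : Integrable f (π.bind K) := by
    rw [hK.def]; exact (Lp.memLp f).integrable (by norm_num)
  have hcomp : ∫ y, f y ∂(π.bind K) = ∫ x, ∫ y, f y ∂K x ∂π := by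
    rw [Measure.comp_eq_comp_const_apply] at hint ⊢
    rw [Kernel.integral_comp hint, Kernel.const_apply]
  rw [integral_congr_ae (markovOp_coeFn K π hK f), ← hcomp, hK.def]
  exact hf

/-- The restriction `P : L₂⁰(π) → L₂⁰(π)` of the Markov operator. -/
def markovOp0 (K : Kernel X X) [IsMarkovKernel K] (π : Measure X) [IsProbabilityMeasure π]
    (hK : K.Invariant π) : L20 π →L[ℝ] L20 π :=
  (markovOp K π hK).restrict (markovOp_mem_L20 K π hK)

/-- `Λ = sup {λ : λ ∈ spec(P | L₂⁰)}`. (If `L₂⁰ = {0}`, the spectrum is empty and the supremum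
is `0` by convention; only `max 0 Λ`, `|Λ|` and `Λ < 1` are used.) -/
def specSup (K : Kernel X X) [IsMarkovKernel K] (π : Measure X) [IsProbabilityMeasure π]
    (hK : K.Invariant π) : ℝ :=
  sSup (spectrum ℝ (markovOp0 K π hK))

/-- `K` (or its Markov operator) is variance bounding: `Λ < 1`. -/
def VarianceBounding (K : Kernel X X) [IsMarkovKernel K] (π : Measure X)
    [IsProbabilityMeasure π] (hK : K.Invariant π) : Prop :=
  specSup K π hK < 1

/-- `β = ‖P‖_{L₂⁰ → L₂⁰}`, the operator norm. -/
def opNorm0 (K : Kernel X X) [IsMarkovKernel K] (π : Measure X) [IsProbabilityMeasure π]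
    (hK : K.Invariant π) : ℝ :=
  ‖markovOp0 K π hK‖

/-- `K` (or its Markov operator) has an absolute `L₂`-spectral gap: `β < 1`. -/
def HasAbsSpectralGap (K : Kernel X X) [IsMarkovKernel K] (π : Measure X)
    [IsProbabilityMeasure π] (hK : K.Invariant π) : Prop :=
  opNorm0 K π hK < 1

/-- The measure `ν Pᵐ`, where `(μ P)(A) = ∫ K(x, A) μ(dx)`. -/
def iterMeasure (K : Kernel X X) (ν : Measure X) (m : ℕ) : Measure X :=
  (fun μ : Measure X => μ.bind K)^[m] ν

/-- The density `dν/dπ` exists and belongs to `L₂(π)`. -/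
def HasL2Density (ν π : Measure X) : Prop :=
  ν ≪ π ∧ MemLp (fun x => (ν.rnDeriv π x).toReal) 2 π

/-- `‖dν/dπ‖₂`. -/
def densityNorm (ν π : Measure X) : ℝ :=
  (eLpNorm (fun x => (ν.rnDeriv π x).toReal) 2 π).toReal

/-- `‖dν/dπ - 1‖₂`. -/
def densitySubOneNorm (ν π : Measure X) : ℝ :=
  (eLpNorm (fun x => (ν.rnDeriv π x).toReal - 1) 2 π).toReal

end MarkovOperator

section Driver

/-- The unit cube `[0,1]^s`, with Lebesgue measure `volume`. -/
abbrev Cube (s : ℕ) : Type := Fin s → unitInterval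

variable {X : Type*} [MeasurableSpace X] {s : ℕ}

/-- `φ` is an update function of `K`. -/
def IsUpdateFunction (φ : X → Cube s → X) (K : Kernel X X) : Prop :=
  Measurable (fun p : X × Cube s => φ p.1 p.2) ∧
    ∀ (x : X) (A : Set X), MeasurableSet A → K x A = volume {u : Cube s | φ x u ∈ A}

/-- `ψ` is a generator function of `ν`. -/
def IsGeneratorFunction (ψ : Cube s → X) (ν : Measure X) : Prop :=
  Measurable ψ ∧ ∀ A : Set X, MeasurableSet A → ν A = volume {u : Cube s | ψ u ∈ A}

/-- `chainState φ ψ i (u₀, …, uᵢ) = φᵢ(ψ(u₀); u₁, …, uᵢ) = x_{i+1}`, that is, `x₁ = ψ(u₀)` and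
`x_{i+1} = φ(xᵢ; uᵢ)`. -/
def chainState (φ : X → Cube s → X) (ψ : Cube s → X) : (i : ℕ) → (Fin (i + 1) → Cube s) → X
  | 0, u => ψ (u 0)
  | i + 1, u => φ (chainState φ ψ i (Fin.init u)) (u (Fin.last (i + 1)))

/-- The set `C_{i,ψ}(A) ⊆ [0,1]^{(i+1)s}`. -/
def pullBack (φ : X → Cube s → X) (ψ : Cube s → X) (i : ℕ) (A : Set X) :
    Set (Fin (i + 1) → Cube s) :=
  {u | chainState φ ψ i u ∈ A}

/-- The initial segment `(u₀, …, uᵢ)` of a finite sequence `u₀, …, u_{N-1}`. -/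
def initialSegment {N : ℕ} (u : Fin N → Cube s) (i : Fin N) : Fin (i.val + 1) → Cube s :=
  fun k => u (Fin.castLE i.isLt k)

/-- The points `x_{n₀+1}, …, x_{n₀+n}` generated by the driver sequence
`u₀, …, u_{n₀+n-1}`. -/
def burnInPoints (φ : X → Cube s → X) (ψ : Cube s → X) (n₀ n : ℕ)
    (u : Fin (n₀ + n) → Cube s) (j : Fin n) : X :=
  chainState φ ψ (n₀ + j.val) (initialSegment u (Fin.natAdd n₀ j))

/-- The star-discrepancy of the points `z₁, …, zₙ` with respect to the probability measure `π`
and the class `𝒜` of test sets. -/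
def starDiscrepancy (𝒜 : Set (Set X)) (π : Measure X) {n : ℕ} (z : Fin n → X) : ℝ :=
  ⨆ A : 𝒜, |(1 / (n : ℝ)) * ∑ j : Fin n, (A : Set X).indicator (fun _ => (1 : ℝ)) (z j) -
    π.real (A : Set X)|

/-- The local discrepancy function with burn-in of a driver sequence `u₀, …, u_{n₀+n-1}`. The
summation index is `i = n₀ + j`, `0 ≤ j < n`. -/
def localDiscrepancyBurnIn (φ : X → Cube s → X) (ψ : Cube s → X) (n₀ n : ℕ) (A : Set X)
    (u : Fin (n₀ + n) → Cube s) : ℝ :=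
  (1 / (n : ℝ)) * ∑ j : Fin n,
    ((pullBack φ ψ (n₀ + j.val) A).indicator (fun _ => (1 : ℝ))
        (initialSegment u (Fin.natAdd n₀ j)) -
      volume.real (pullBack φ ψ (n₀ + j.val) A))

/-- The pull-back discrepancy with burn-in. -/
def pullBackDiscrepancyBurnIn (𝒜 : Set (Set X)) (φ : X → Cube s → X) (ψ : Cube s → X)
    (n₀ n : ℕ) (u : Fin (n₀ + n) → Cube s) : ℝ :=
  ⨆ A : 𝒜, |localDiscrepancyBurnIn φ ψ n₀ n (A : Set X) u|

/-- The finite family `Γ` of measurable sets is a `δ`-cover of `𝒜` with respect to `π`. -/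
structure IsDeltaCover (π : Measure X) (𝒜 : Set (Set X)) (δ : ℝ) (Γ : Finset (Set X)) :
    Prop where
  measurableSet : ∀ C ∈ Γ, MeasurableSet C
  empty_mem : ∅ ∈ Γ
  bracket : ∀ A ∈ 𝒜, ∃ C ∈ Γ, ∃ D ∈ Γ, C ⊆ A ∧ A ⊆ D ∧ π.real (D \ C) ≤ δ

end Driver

end MCQMC

end

/-!
Let `Π` be the projection of `L²(π)` onto the constants. Reversibility and `Λ < 1` give
`P ≤ Λ₀ + (1 - Λ₀) Π` as quadratic forms. Conjugation by `exp (t 1_A / 2)` makes the Feynman–Kac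
operator `h ↦ P (exp (t 1_A) h)` self-adjoint, and by Cauchy–Schwarz on `A` and on its complement
the resulting quadratic form is at most that of a two-state chain, whose top eigenvalue is at most
`exp (t π(A) + R t² / 8)` with `R = (1 + Λ₀) / (1 - Λ₀)`. A further Cauchy–Schwarz inequality splits
off the density of `νP^{n₀}` at the cost of replacing `t` by `2 t`; it bounds the exponential moment
of the number of visits to `A`, and Chernoff's inequality yields the tail
`2 ‖d(νP^{n₀})/dπ‖₂ exp (-n ε² / R)`. A union bound over `Γ_δ \ {∅}` produces the driver sequence,
and bracketing passes from `Γ_δ` to `𝒜`.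

The two discrepancies differ by the bias
`n⁻¹ ∑_{j < n} (νP^{n₀ + j}(A) - π(A)) = n⁻¹ ⟨∑_{j < n} P^j P^{n₀} (dν/dπ - 1), 1_A⟩`. On `L²₀` one
has `0 ≤ ∑_{j < n} P^j ≤ ∑_{j < n} Λ₀^j`, even though the norm `β` of `P` may exceed `Λ₀`.
-/

noncomputable section

namespace MCQMC

section Hilbert

open scoped InnerProductSpace

variable {E : Type*} [NormedAddCommGroup E] [InnerProductSpace ℝ E]

lemma norm_le_of_forall_abs_inner_le {T : E →L[ℝ] E} (hT : (T : E →ₗ[ℝ] E).IsSymmetric) {c : ℝ}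
    (hc : 0 ≤ c) (h : ∀ x, |⟪T x, x⟫_ℝ| ≤ c * ‖x‖ ^ 2) : ‖T‖ ≤ c := by
  rw [T.norm_eq_iSup_rayleighQuotient hT]
  refine ciSup_le fun x => ?_
  rw [ContinuousLinearMap.rayleighQuotient, abs_div, abs_sq]
  exact div_le_of_le_mul₀ (sq_nonneg _) hc (h x)

lemma abs_inner_self_le_opNorm (T : E →L[ℝ] E) (x : E) : |⟪T x, x⟫_ℝ| ≤ ‖T‖ * ‖x‖ ^ 2 :=
  calc |⟪T x, x⟫_ℝ| ≤ ‖T x‖ * ‖x‖ := abs_real_inner_le_norm _ _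
    _ ≤ ‖T‖ * ‖x‖ * ‖x‖ := by gcongr; exact T.le_opNorm x
    _ = ‖T‖ * ‖x‖ ^ 2 := by ring

lemma isPositive_smul_one_sub {T : E →L[ℝ] E} (hT : (T : E →ₗ[ℝ] E).IsSymmetric) {c : ℝ}
    (h : ∀ x, ⟪T x, x⟫_ℝ ≤ c * ‖x‖ ^ 2) : (c • (1 : E →L[ℝ] E) - T).IsPositive := by
  refine ⟨(LinearMap.IsSymmetric.id.smul (IsSelfAdjoint.all c)).sub hT, fun x => ?_⟩
  have := h x
  simp only [ContinuousLinearMap.reApplyInnerSelf_apply, RCLike.re_to_real, sub_apply, smul_apply,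
    one_apply_eq_self, inner_sub_left, real_inner_smul_left, real_inner_self_eq_norm_sq]
  linarith

lemma isPositive_smul_one_add {T : E →L[ℝ] E} (hT : (T : E →ₗ[ℝ] E).IsSymmetric) {c : ℝ}
    (h : ∀ x, -(c * ‖x‖ ^ 2) ≤ ⟪T x, x⟫_ℝ) : (c • (1 : E →L[ℝ] E) + T).IsPositive := by
  have hneg : ((-T : E →L[ℝ] E) : E →ₗ[ℝ] E).IsSymmetric :=
    fun x y => by simpa using hT x y
  rw [← sub_neg_eq_add]
  refine isPositive_smul_one_sub hneg fun x => ?_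
  rw [neg_apply, inner_neg_left]
  linarith [h x]

lemma norm_mem_spectrum_of_isPositive [Nontrivial E] {A : E →L[ℝ] E} (hA : A.IsPositive) :
    ‖A‖ ∈ spectrum ℝ A := by
  by_contra hres
  obtain ⟨ε, hε, hle⟩ :=
    A.rayleighQuotient_le_of_norm_mem_resolventSet (spectrum.notMem_iff.1 hres)
  have hnorm : ‖A‖ ≤ ‖A‖ - ε := by
    conv_lhs => rw [A.norm_eq_iSup_rayleighQuotient hA.isSymmetric]
    refine ciSup_le fun x => ?_
    rw [abs_of_nonneg (div_nonneg (hA.2 x) (sq_nonneg _))]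
    exact hle x
  linarith

lemma exists_mem_spectrum_forall_inner_le [Nontrivial E] {T : E →L[ℝ] E}
    (hT : (T : E →ₗ[ℝ] E).IsSymmetric) :
    ∃ M ∈ spectrum ℝ T, ∀ x, ⟪T x, x⟫_ℝ ≤ M * ‖x‖ ^ 2 := by
  set A : E →L[ℝ] E := ‖T‖ • 1 + T with hA
  have hApos : A.IsPositive :=
    isPositive_smul_one_add hT fun x => (abs_le.1 (abs_inner_self_le_opNorm T x)).1
  refine ⟨‖A‖ - ‖T‖, ?_, fun x => ?_⟩
  · rw [← spectrum.add_mem_add_iff (s := ‖T‖), sub_add_cancel, Algebra.algebraMap_eq_smul_one]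
    exact norm_mem_spectrum_of_isPositive hApos
  · have hAx := (abs_le.1 (abs_inner_self_le_opNorm A x)).2
    rw [hA, add_apply, smul_apply, one_apply_eq_self, inner_add_left, real_inner_smul_left,
      real_inner_self_eq_norm_sq] at hAx
    linarith

lemma bddAbove_spectrum [CompleteSpace E] [Nontrivial E] (T : E →L[ℝ] E) :
    BddAbove (spectrum ℝ T) :=
  ⟨‖T‖, fun _ hr => (abs_le.1 (spectrum.norm_le_norm_of_mem hr)).2⟩

lemma inner_le_sSup_spectrum [CompleteSpace E] {T : E →L[ℝ] E}
    (hT : (T : E →ₗ[ℝ] E).IsSymmetric) (x : E) :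
    ⟪T x, x⟫_ℝ ≤ sSup (spectrum ℝ T) * ‖x‖ ^ 2 := by
  rcases subsingleton_or_nontrivial E with h | h
  · simp [Subsingleton.elim x 0]
  obtain ⟨M, hM, hle⟩ := exists_mem_spectrum_forall_inner_le hT
  refine (hle x).trans ?_
  gcongr
  exact le_csSup (bddAbove_spectrum T) hM

lemma abs_sSup_spectrum_le_opNorm [CompleteSpace E] {T : E →L[ℝ] E}
    (hT : (T : E →ₗ[ℝ] E).IsSymmetric) : |sSup (spectrum ℝ T)| ≤ ‖T‖ := by
  rcases subsingleton_or_nontrivial E with h | h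
  · simp [spectrum.of_subsingleton]
  obtain ⟨M, hM, -⟩ := exists_mem_spectrum_forall_inner_le hT
  have hbound : ∀ r ∈ spectrum ℝ T, -‖T‖ ≤ r ∧ r ≤ ‖T‖ := fun r hr =>
    abs_le.1 (spectrum.norm_le_norm_of_mem hr)
  exact abs_le.2 ⟨(hbound M hM).1.trans (le_csSup (bddAbove_spectrum T) hM),
    csSup_le ⟨M, hM⟩ fun r hr => (hbound r hr).2⟩

section GeometricSum

variable [CompleteSpace E] {T : E →L[ℝ] E} {l : ℝ}

lemma isPositive_mul_mul_self {A B : E →L[ℝ] E} (hA : A.IsPositive) (hB : IsSelfAdjoint B) :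
    (B * A * B).IsPositive := by
  have := hA.conj_adjoint B
  rwa [hB.adjoint_eq] at this

lemma isPositive_smul_one_sub_mul_one_add (hl : 0 ≤ l)
    (hlT : (l • (1 : E →L[ℝ] E) - T).IsPositive) (hT1 : (1 + T).IsPositive) :
    ((l • (1 : E →L[ℝ] E) - T) * (1 + T)).IsPositive := by
  -- The factors `a`, `b` commute and sum to `1 + l`, hence `(1 + l) a b = a b a + b a b`.
  have hsum := ((isPositive_mul_mul_self hT1 hlT.isSelfAdjoint).add
    (isPositive_mul_mul_self hlT hT1.isSelfAdjoint)).smul_of_nonneg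
      (c := (1 + l)⁻¹) (by positivity)
  convert hsum using 1
  rw [eq_inv_smul_iff₀ (by positivity : (1 + l) ≠ 0)]
  simp only [add_smul, one_smul, mul_add, add_mul, sub_mul, mul_sub, smul_mul_assoc,
    mul_smul_comm, one_mul, mul_one, smul_sub, smul_add, mul_assoc]
  abel

lemma geom_sum_add_two {R : Type*} [Ring R] (a : R) (n : ℕ) :
    ∑ j ∈ Finset.range (n + 2), a ^ j = (1 + a) + a * (∑ j ∈ Finset.range n, a ^ j) * a := by
  have hlast : ∑ j ∈ Finset.range (n + 1), a ^ j = (∑ j ∈ Finset.range n, a ^ j) * a + 1 := by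
    rw [Finset.sum_range_succ', Finset.sum_mul, pow_zero]
    simp only [pow_succ]
  rw [geom_sum_succ, hlast, mul_add, mul_one, mul_assoc]
  abel

lemma isPositive_geom_sum (hT1 : (1 + T).IsPositive)
    (hT : IsSelfAdjoint T) (n : ℕ) : (∑ j ∈ Finset.range n, T ^ j).IsPositive := by
  induction n using Nat.twoStepInduction with
  | zero => simp
  | one => simp
  | more n ih _ =>
    rw [geom_sum_add_two]
    exact hT1.add (isPositive_mul_mul_self ih hT)

lemma isPositive_smul_one_sub_mul_geom_sum (hl : 0 ≤ l)
    (hlT : (l • (1 : E →L[ℝ] E) - T).IsPositive) (hT1 : (1 + T).IsPositive)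
    (hT : IsSelfAdjoint T) (n : ℕ) :
    ((l • (1 : E →L[ℝ] E) - T) * ∑ j ∈ Finset.range n, T ^ j).IsPositive := by
  induction n using Nat.twoStepInduction with
  | zero => simp
  | one => simpa using hlT
  | more n ih _ =>
    rw [geom_sum_add_two, mul_add]
    refine (isPositive_smul_one_sub_mul_one_add hl hlT hT1).add ?_
    have hcomm : (l • (1 : E →L[ℝ] E) - T) * (T * (∑ j ∈ Finset.range n, T ^ j) * T) =
        T * ((l • (1 : E →L[ℝ] E) - T) * ∑ j ∈ Finset.range n, T ^ j) * T := by
      simp only [sub_mul, mul_sub, smul_mul_assoc, mul_smul_comm, one_mul, mul_assoc]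
    rw [hcomm]
    exact isPositive_mul_mul_self ih hT

lemma isPositive_geom_sum_smul_one_sub_geom_sum (hl : 0 ≤ l)
    (hlT : (l • (1 : E →L[ℝ] E) - T).IsPositive) (hT1 : (1 + T).IsPositive)
    (hT : IsSelfAdjoint T) (n : ℕ) :
    ((∑ j ∈ Finset.range n, l ^ j) • (1 : E →L[ℝ] E) -
      ∑ j ∈ Finset.range n, T ^ j).IsPositive := by
  induction n with
  | zero => simp
  | succ n ih =>
    convert (ih.smul_of_nonneg hl).add
      (isPositive_smul_one_sub_mul_geom_sum hl hlT hT1 hT n) using 1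
    rw [geom_sum_succ, geom_sum_succ]
    simp only [sub_mul, smul_sub, add_smul, smul_smul, one_smul, smul_mul_assoc, one_mul]
    abel

lemma norm_geom_sum_le (hl : 0 ≤ l) (hT : (T : E →ₗ[ℝ] E).IsSymmetric)
    (hge : ∀ x, -‖x‖ ^ 2 ≤ ⟪T x, x⟫_ℝ) (hle : ∀ x, ⟪T x, x⟫_ℝ ≤ l * ‖x‖ ^ 2) (n : ℕ) :
    ‖∑ j ∈ Finset.range n, T ^ j‖ ≤ ∑ j ∈ Finset.range n, l ^ j := by
  have hlT := isPositive_smul_one_sub hT hle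
  have hT1 : (1 + T).IsPositive := by
    simpa using isPositive_smul_one_add (c := 1) hT fun x => by simpa using hge x
  have hsum := isPositive_geom_sum hT1 hT.isSelfAdjoint n
  refine norm_le_of_forall_abs_inner_le hsum.isSymmetric
    (Finset.sum_nonneg fun j _ => by positivity) fun x => ?_
  rw [abs_of_nonneg (hsum.inner_nonneg_left x)]
  have hsub := (isPositive_geom_sum_smul_one_sub_geom_sum hl hlT hT1 hT.isSelfAdjoint n
    ).inner_nonneg_left x
  rw [sub_apply, smul_apply, one_apply_eq_self, inner_sub_left, real_inner_smul_left,
    real_inner_self_eq_norm_sq] at hsub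
  linarith

end GeometricSum

end Hilbert

section Hoeffding

lemma integral_exp_mul_indicator_le {X : Type*} [MeasurableSpace X] (π : Measure X)
    [IsProbabilityMeasure π] {A : Set X} (hA : MeasurableSet A) (t : ℝ) :
    ∫ x, Real.exp (t * A.indicator 1 x) ∂π ≤ Real.exp (t * π.real A + t ^ 2 / 8) := by
  have hmem : ∀ᵐ x ∂π, A.indicator (1 : X → ℝ) x ∈ Set.Icc (0 : ℝ) 1 :=
    .of_forall fun x => ⟨Set.indicator_nonneg (fun _ _ => zero_le_one) x,
      Set.indicator_le_self' (fun _ _ => zero_le_one) x⟩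
  have hcentered := (hasSubgaussianMGF_of_mem_Icc
    (measurable_one.indicator hA).aemeasurable hmem).mgf_le t
  rw [integral_indicator_one hA] at hcentered
  calc ∫ x, Real.exp (t * A.indicator 1 x) ∂π
      = Real.exp (t * π.real A) * mgf (fun x => A.indicator 1 x - π.real A) π t := by
        rw [mgf, ← integral_const_mul]
        congr 1 with x
        rw [← Real.exp_add]
        ring_nf
    _ ≤ Real.exp (t * π.real A) * Real.exp (t ^ 2 / 8) := by
        gcongr
        refine hcentered.trans_eq ?_
        norm_num
        ring
    _ = Real.exp (t * π.real A + t ^ 2 / 8) := (Real.exp_add _ _).symm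

lemma exp_mul_indicator_one {X : Type*} (A : Set X) (t : ℝ) (x : X) :
    Real.exp (t * A.indicator 1 x) = 1 + A.indicator (fun _ => Real.exp t - 1) x := by
  by_cases hx : x ∈ A <;> simp [hx]

lemma one_add_mul_exp_sub_one_le {p : ℝ} (hp : p ∈ Set.Icc (0 : ℝ) 1) (t : ℝ) :
    1 + p * (Real.exp t - 1) ≤ Real.exp (t * p + t ^ 2 / 8) := by
  have hreal : (volume : Measure unitInterval).real (Set.Iic ⟨p, hp⟩) = p := by
    rw [measureReal_def, unitInterval.volume_Iic, ENNReal.toReal_ofReal hp.1]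
  have h := integral_exp_mul_indicator_le (volume : Measure unitInterval)
    (measurableSet_Iic (a := (⟨p, hp⟩ : unitInterval))) t
  simp only [exp_mul_indicator_one] at h
  rw [integral_add (integrable_const _) ((integrable_const _).indicator measurableSet_Iic),
    integral_indicator_const _ measurableSet_Iic, hreal] at h
  simpa using h

lemma cosh_add_mul_sinh_le_exp {m : ℝ} (hm : |m| ≤ 1) (h : ℝ) :
    Real.cosh h + m * Real.sinh h ≤ Real.exp (m * h + h ^ 2 / 2) := by
  obtain ⟨hm₀, hm₁⟩ := abs_le.1 hm
  calc Real.cosh h + m * Real.sinh h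
      = Real.exp (-h) * (1 + (1 + m) / 2 * (Real.exp (2 * h) - 1)) := by
        rw [two_mul, Real.exp_add, Real.cosh_eq, Real.sinh_eq, Real.exp_neg]
        field_simp
        ring
    _ ≤ Real.exp (-h) * Real.exp (2 * h * ((1 + m) / 2) + (2 * h) ^ 2 / 8) := by
        gcongr
        exact one_add_mul_exp_sub_one_le ⟨by linarith, by linarith⟩ _
    _ = Real.exp (m * h + h ^ 2 / 2) := by
        rw [← Real.exp_add]
        ring_nf

end Hoeffding

section TwoState

lemma sinh_le_mul_exp (h : ℝ) : Real.sinh h ≤ h * Real.exp h := by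
  have hexp : Real.exp h * Real.exp (-(2 * h)) = Real.exp (-h) := by
    rw [← Real.exp_add]
    ring_nf
  rw [Real.sinh_eq]
  nlinarith [Real.add_one_le_exp (-(2 * h)), Real.exp_pos h]

lemma cosh_add_mul_sinh_le_exp_of_neg_one_le {m : ℝ} (hm : -1 ≤ m) (h : ℝ) :
    Real.cosh h + m * Real.sinh h ≤ Real.exp (m * h + h ^ 2 / 2) := by
  rcases le_total m 1 with hm₁ | hm₁
  · exact cosh_add_mul_sinh_le_exp (abs_le.2 ⟨hm, hm₁⟩) h
  calc Real.cosh h + m * Real.sinh h = Real.exp h + (m - 1) * Real.sinh h := by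
        rw [← Real.cosh_add_sinh]
        ring
    _ ≤ Real.exp h + (m - 1) * (h * Real.exp h) := by
        gcongr
        exact sinh_le_mul_exp h
    _ ≤ Real.exp h * ((m - 1) * h + h ^ 2 / 2 + 1) := by
        nlinarith [Real.exp_pos h, sq_nonneg h]
    _ ≤ Real.exp h * Real.exp ((m - 1) * h + h ^ 2 / 2) := by
        gcongr
        exact Real.add_one_le_exp _
    _ = Real.exp (m * h + h ^ 2 / 2) := by
        rw [← Real.exp_add]
        ring_nf

lemma sinh_le_mul_cosh {k : ℝ} (hk : 0 ≤ k) : Real.sinh k ≤ k * Real.cosh k := by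
  have hderiv : ∀ x ∈ Set.Icc 0 k, ‖deriv Real.sinh x‖ ≤ Real.cosh k := by
    intro x hx
    rw [Real.deriv_sinh, Real.norm_of_nonneg (Real.cosh_pos x).le, Real.cosh_le_cosh]
    exact abs_le_abs_of_nonneg hx.1 hx.2
  have hmean := (convex_Icc 0 k).norm_image_sub_le_of_norm_deriv_le
    (fun x _ => Real.differentiable_sinh x) hderiv ⟨le_rfl, hk⟩ ⟨hk, le_rfl⟩
  rw [Real.sinh_zero, sub_zero, sub_zero, Real.norm_of_nonneg hk, mul_comm] at hmean
  exact (Real.le_norm_self _).trans hmean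

lemma cosh_sub_one_le {h : ℝ} (hh : 0 ≤ h) : Real.cosh h - 1 ≤ h / 2 * Real.sinh h := by
  obtain ⟨k, rfl⟩ : ∃ k, h = 2 * k := ⟨h / 2, by ring⟩
  have hk : 0 ≤ k := by linarith
  rw [Real.cosh_two_mul, Real.sinh_two_mul, Real.cosh_sq]
  nlinarith [mul_le_mul_of_nonneg_left (sinh_le_mul_cosh hk) (Real.sinh_nonneg_iff.2 hk)]

lemma mul_cosh_add_mul_sinh_le {R m : ℝ} (hR : 1 ≤ R) (hm : |m| ≤ 1) (h : ℝ) :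
    R * Real.cosh h + m * Real.sinh h ≤
      R * Real.cosh (m * h + R * h ^ 2 / 2) + Real.sinh (m * h + R * h ^ 2 / 2) := by
  wlog hh : 0 ≤ h generalizing h m
  · simpa using this (m := -m) (by rwa [abs_neg]) (-h) (by linarith)
  have hshift : -1 ≤ m + (R - 1) * h / 2 := by
    have := mul_nonneg (sub_nonneg.2 hR) hh
    linarith [(abs_le.1 hm).1]
  have hexp := cosh_add_mul_sinh_le_exp_of_neg_one_le hshift h
  rw [show (m + (R - 1) * h / 2) * h + h ^ 2 / 2 = m * h + R * h ^ 2 / 2 by ring,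
    ← Real.cosh_add_sinh] at hexp
  have hcosh := mul_nonneg (sub_nonneg.2 hR) (sub_nonneg.2 ((cosh_sub_one_le hh).trans' <|
    sub_le_sub_left (Real.one_le_cosh (m * h + R * h ^ 2 / 2)) _))
  linarith

lemma quadratic_form_nonneg {a b c : ℝ} (ha : 0 ≤ a) (hc : 0 ≤ c) (hdet : b ^ 2 ≤ a * c)
    (x y : ℝ) : 0 ≤ a * x ^ 2 - 2 * b * x * y + c * y ^ 2 := by
  have hb : |b| ≤ √a * √c := by
    rw [← Real.sqrt_mul ha]
    exact Real.abs_le_sqrt hdet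
  have hcross : 2 * b * x * y ≤ 2 * (√a * √c) * (|x| * |y|) := by
    calc 2 * b * x * y ≤ |2 * b * x * y| := le_abs_self _
      _ = 2 * |b| * (|x| * |y|) := by rw [abs_mul, abs_mul, abs_mul, abs_two]; ring
      _ ≤ _ := by gcongr
  have hsq := sq_nonneg (√a * |x| - √c * |y|)
  rw [sub_sq, mul_pow, mul_pow, sq_abs, sq_abs, Real.sq_sqrt ha, Real.sq_sqrt hc] at hsq
  linarith

lemma quadratic_form_le {a b c q : ℝ} (hq : 0 < q) (hchar : b ^ 2 ≤ (q - a) * (q - c))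
    (hdet : a * c - b ^ 2 ≤ q ^ 2) (x y : ℝ) :
    a * x ^ 2 + 2 * b * x * y + c * y ^ 2 ≤ q * (x ^ 2 + y ^ 2) := by
  have hprod : 0 ≤ (q - a) * (q - c) := (sq_nonneg b).trans hchar
  have htrace : a + c ≤ 2 * q := by
    have : q * (a + c - 2 * q) ≤ 0 := by linarith
    linarith [nonpos_of_mul_nonpos_right this hq]
  have hdiag : 0 ≤ q - a ∧ 0 ≤ q - c := by
    rcases nonneg_and_nonneg_or_nonpos_and_nonpos_of_mul_nonneg hprod with h | h
    · exact h
    · constructor <;> linarith [h.1, h.2]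
  linarith [quadratic_form_nonneg hdiag.1 hdiag.2 hchar x y]

/-- `(1 + l) / (1 - l)`: the factor by which a Poincaré inequality with constant `l` worsens the
variance proxy of independent sampling. -/
def varianceFactor (l : ℝ) : ℝ := (1 + l) / (1 - l)

variable {l : ℝ}

lemma varianceFactor_mul_one_sub (hl₁ : l < 1) : varianceFactor l * (1 - l) = 1 + l :=
  div_mul_cancel₀ _ (sub_pos.2 hl₁).ne'

lemma one_le_varianceFactor (hl₀ : 0 ≤ l) (hl₁ : l < 1) : 1 ≤ varianceFactor l := by
  rw [varianceFactor, le_div_iff₀ (sub_pos.2 hl₁)]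
  linarith

/-- The two-state form has determinant `l`, so its characteristic polynomial is nonnegative at
`q > 0` exactly when its trace is at most `q + l / q`. -/
lemma two_state_trace_le {p : ℝ} (hl₀ : 0 ≤ l) (hl₁ : l < 1) (hp : p ∈ Set.Icc (0 : ℝ) 1)
    (h : ℝ) :
    Real.exp h * (l + (1 - l) * p) + Real.exp (-h) * (l + (1 - l) * (1 - p)) ≤
      Real.exp ((2 * p - 1) * h + varianceFactor l * h ^ 2 / 2) +
        l * Real.exp (-((2 * p - 1) * h + varianceFactor l * h ^ 2 / 2)) := by
  have hm : |2 * p - 1| ≤ 1 := abs_le.2 ⟨by linarith [hp.1], by linarith [hp.2]⟩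
  have hmul := mul_le_mul_of_nonneg_right
    (mul_cosh_add_mul_sinh_le (one_le_varianceFactor hl₀ hl₁) hm h) (sub_pos.2 hl₁).le
  simp only [add_mul, mul_right_comm (varianceFactor l) _ (1 - l),
    varianceFactor_mul_one_sub hl₁, Real.cosh_eq, Real.sinh_eq] at hmul
  linarith

lemma le_exp_two_mul {m : ℝ} (hl₀ : 0 ≤ l) (hl₁ : l < 1) (hm : |m| ≤ 1) (h : ℝ) :
    l ≤ Real.exp (2 * (m * h + varianceFactor l * h ^ 2 / 2)) := by
  have hcompleted : (1 + l) * (2 * (m * h + varianceFactor l * h ^ 2 / 2)) =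
      (1 - l) * ((varianceFactor l * h + m) ^ 2 - m ^ 2) := by
    rw [← varianceFactor_mul_one_sub hl₁]
    ring
  have hm' : m ^ 2 ≤ 1 := (sq_le_one_iff_abs_le_one m).2 hm
  have hlower : l - 1 ≤ 2 * (m * h + varianceFactor l * h ^ 2 / 2) := by
    nlinarith [sq_nonneg (varianceFactor l * h + m)]
  linarith [Real.add_one_le_exp (2 * (m * h + varianceFactor l * h ^ 2 / 2))]

lemma two_state_normalized_le {p : ℝ} (hl₀ : 0 ≤ l) (hl₁ : l < 1) (hp : p ∈ Set.Icc (0 : ℝ) 1)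
    (h x y : ℝ) :
    Real.exp h * (l + (1 - l) * p) * x ^ 2 + 2 * ((1 - l) * √p * √(1 - p)) * x * y +
        Real.exp (-h) * (l + (1 - l) * (1 - p)) * y ^ 2 ≤
      Real.exp ((2 * p - 1) * h + varianceFactor l * h ^ 2 / 2) * (x ^ 2 + y ^ 2) := by
  have hm : |2 * p - 1| ≤ 1 := abs_le.2 ⟨by linarith [hp.1], by linarith [hp.2]⟩
  have htrace := two_state_trace_le hl₀ hl₁ hp h
  have hle := le_exp_two_mul hl₀ hl₁ hm h
  set w := (2 * p - 1) * h + varianceFactor l * h ^ 2 / 2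
  have hb : ((1 - l) * √p * √(1 - p)) ^ 2 = (1 - l) ^ 2 * p * (1 - p) := by
    rw [mul_pow, mul_pow, Real.sq_sqrt hp.1, Real.sq_sqrt (by linarith [hp.2])]
  have hdet : Real.exp h * (l + (1 - l) * p) * (Real.exp (-h) * (l + (1 - l) * (1 - p))) -
      ((1 - l) * √p * √(1 - p)) ^ 2 = l := by
    rw [mul_mul_mul_comm, ← Real.exp_add, add_neg_cancel, Real.exp_zero, hb]
    ring
  refine quadratic_form_le (Real.exp_pos w) ?_ ?_ x y
  · have hmul := mul_le_mul_of_nonneg_left htrace (Real.exp_pos w).le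
    have hw : Real.exp w * Real.exp (-w) = 1 := by rw [← Real.exp_add]; simp
    linear_combination hmul - hdet + l * hw
  · rwa [hdet, ← Real.exp_nat_mul, Nat.cast_ofNat]

lemma two_state_quadratic_le {p : ℝ} (hl₀ : 0 ≤ l) (hl₁ : l < 1) (hp : p ∈ Set.Icc (0 : ℝ) 1)
    (t x y : ℝ) :
    l * (Real.exp t * x ^ 2 + y ^ 2) +
        (1 - l) * (Real.exp (t / 2) * √p * x + √(1 - p) * y) ^ 2 ≤
      Real.exp (t * p + varianceFactor l * t ^ 2 / 8) * (x ^ 2 + y ^ 2) := by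
  have hform := mul_le_mul_of_nonneg_left
    (two_state_normalized_le hl₀ hl₁ hp (t / 2) x y) (Real.exp_pos (t / 2)).le
  have hone : Real.exp (t / 2) * Real.exp (-(t / 2)) = 1 := by rw [← Real.exp_add]; simp
  have hsq : Real.exp t = Real.exp (t / 2) ^ 2 := by rw [← Real.exp_nat_mul]; ring_nf
  have hΘ : Real.exp (t * p + varianceFactor l * t ^ 2 / 8) = Real.exp (t / 2) *
      Real.exp ((2 * p - 1) * (t / 2) + varianceFactor l * (t / 2) ^ 2 / 2) := by
    rw [← Real.exp_add]
    ring_nf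
  have hp₀ : √p ^ 2 = p := Real.sq_sqrt hp.1
  have hp₁ : √(1 - p) ^ 2 = 1 - p := Real.sq_sqrt (by linarith [hp.2])
  rw [hΘ, hsq]
  refine le_trans (le_of_eq ?_) (hform.trans_eq (mul_assoc _ _ _).symm)
  linear_combination (1 - l) * Real.exp (t / 2) ^ 2 * x ^ 2 * hp₀ + (1 - l) * y ^ 2 * hp₁ -
    (l + (1 - l) * (1 - p)) * y ^ 2 * hone

end TwoState

section ReversibleOperator

open scoped InnerProductSpace

variable {X : Type*} [MeasurableSpace X] {K : Kernel X X} [IsMarkovKernel K] {π : Measure X}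
  [IsProbabilityMeasure π]

lemma map_swap_compProd_of_isReversible (hrev : K.IsReversible π) :
    (π ⊗ₘ K).map Prod.swap = π ⊗ₘ K := by
  have := Measure.isFiniteMeasure_map (π ⊗ₘ K) Prod.swap
  refine Measure.ext_prod fun {s t} hs ht => ?_
  rw [Measure.map_apply measurable_swap (hs.prod ht), Set.preimage_swap_prod,
    Measure.compProd_apply_prod ht hs, Measure.compProd_apply_prod hs ht, hrev ht hs]

lemma measurePreserving_fst_compProd : MeasurePreserving Prod.fst (π ⊗ₘ K) π :=
  ⟨measurable_fst, by rw [← Measure.fst, Measure.fst_compProd]⟩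

lemma measurePreserving_snd_compProd (hK : K.Invariant π) :
    MeasurePreserving Prod.snd (π ⊗ₘ K) π :=
  ⟨measurable_snd, by rw [← Measure.snd, Measure.snd_compProd, hK.def]⟩

lemma integrable_mul_compProd (hK : K.Invariant π) {f g : X → ℝ} (hf : MemLp f 2 π)
    (hg : MemLp g 2 π) : Integrable (fun p : X × X => g p.1 * f p.2) (π ⊗ₘ K) :=
  (hg.comp_measurePreserving measurePreserving_fst_compProd).integrable_mul
    (hf.comp_measurePreserving (measurePreserving_snd_compProd hK))

lemma integral_mul_compProd (hK : K.Invariant π) {f g : X → ℝ} (hf : MemLp f 2 π)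
    (hg : MemLp g 2 π) :
    ∫ p, g p.1 * f p.2 ∂(π ⊗ₘ K) = ∫ x, g x * ∫ y, f y ∂K x ∂π := by
  rw [Measure.integral_compProd (integrable_mul_compProd hK hf hg)]
  simp only [integral_const_mul]

lemma integral_mul_kernel_comm (hrev : K.IsReversible π) {f g : X → ℝ} (hf : MemLp f 2 π)
    (hg : MemLp g 2 π) :
    ∫ x, g x * ∫ y, f y ∂K x ∂π = ∫ x, f x * ∫ y, g y ∂K x ∂π := by
  have hmeas : AEStronglyMeasurable (fun p : X × X => f p.1 * g p.2)
      ((π ⊗ₘ K).map Prod.swap) := by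
    rw [map_swap_compProd_of_isReversible hrev]
    exact (integrable_mul_compProd hrev.invariant hg hf).1
  calc ∫ x, g x * ∫ y, f y ∂K x ∂π
      = ∫ p : X × X, f p.swap.1 * g p.swap.2 ∂(π ⊗ₘ K) := by
        simp only [← integral_mul_compProd hrev.invariant hf hg, Prod.fst_swap, Prod.snd_swap,
          mul_comm]
    _ = ∫ p, f p.1 * g p.2 ∂(π ⊗ₘ K) := by
        rw [← integral_map measurable_swap.aemeasurable hmeas,
          map_swap_compProd_of_isReversible hrev]
    _ = ∫ x, f x * ∫ y, g y ∂K x ∂π := integral_mul_compProd hrev.invariant hg hf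

lemma inner_markovOp (hK : K.Invariant π) (f g : Lp ℝ 2 π) :
    ⟪markovOp K π hK f, g⟫_ℝ = ∫ x, g x * ∫ y, f y ∂K x ∂π := by
  rw [L2.inner_def]
  refine integral_congr_ae ?_
  filter_upwards [markovOp_coeFn K π hK f] with x hx
  rw [hx, RCLike.inner_apply, conj_trivial]

lemma isSymmetric_markovOp (hrev : K.IsReversible π) :
    (markovOp K π hrev.invariant : Lp ℝ 2 π →ₗ[ℝ] Lp ℝ 2 π).IsSymmetric := by
  intro f g
  simp only [ContinuousLinearMap.coe_coe]
  rw [inner_markovOp, real_inner_comm, inner_markovOp,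
    integral_mul_kernel_comm hrev (Lp.memLp f) (Lp.memLp g)]

lemma norm_markovOp_apply_le (hK : K.Invariant π) (f : Lp ℝ 2 π) :
    ‖markovOp K π hK f‖ ≤ ‖f‖ := by
  have hnorm : ‖markovOp K π hK‖ ≤ 1 := LinearMap.mkContinuous_norm_le _ zero_le_one _
  simpa using (markovOp K π hK).le_of_opNorm_le hnorm f

lemma markovOp_const (hK : K.Invariant π) (c : ℝ) :
    markovOp K π hK (Lp.const 2 π c) = Lp.const 2 π c := by
  refine Lp.ext ?_
  have hbind : ∀ᵐ y ∂(π.bind K), Lp.const 2 π c y = c := by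
    rw [hK.def]; exact Lp.coeFn_const 2 π c
  filter_upwards [markovOp_coeFn K π hK (Lp.const 2 π c), Lp.coeFn_const 2 π c,
    Measure.ae_ae_of_ae_comp hbind] with x hP hconst hinner
  rw [hP, hconst, integral_congr_ae hinner, integral_const]
  simp

lemma ofReal_markovOp_ae_eq_lintegral (hK : K.Invariant π) {f : Lp ℝ 2 π} (hf : 0 ≤ᵐ[π] f) :
    (fun x => ENNReal.ofReal (markovOp K π hK f x)) =ᵐ[π]
      fun x => ∫⁻ y, ENNReal.ofReal (f y) ∂K x := by
  have hbind : ∀ᵐ y ∂(π.bind K), 0 ≤ f y := by rwa [hK.def]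
  filter_upwards [markovOp_coeFn K π hK f, ae_integrable_kernel hK f,
    Measure.ae_ae_of_ae_comp hbind] with x hP hint hnonneg
  rw [hP, ofReal_integral_eq_lintegral_ofReal hint hnonneg]

lemma inner_const_one (f : Lp ℝ 2 π) : ⟪Lp.const 2 π (1 : ℝ), f⟫_ℝ = ∫ x, f x ∂π := by
  rw [← indicatorConstLp_univ, L2.inner_indicatorConstLp_one, setIntegral_univ]

lemma norm_const_one : ‖Lp.const 2 π (1 : ℝ)‖ = 1 := by
  simp [Lp.norm_const]

lemma mem_L20_iff_inner_const_one {f : Lp ℝ 2 π} :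
    f ∈ L20 π ↔ ⟪Lp.const 2 π (1 : ℝ), f⟫_ℝ = 0 := by
  rw [inner_const_one]; rfl

lemma sub_integral_smul_const_one_mem_L20 (f : Lp ℝ 2 π) :
    f - (∫ x, f x ∂π) • Lp.const 2 π (1 : ℝ) ∈ L20 π := by
  rw [mem_L20_iff_inner_const_one, inner_sub_right, inner_smul_right, real_inner_self_eq_norm_sq,
    norm_const_one, inner_const_one]
  simp

instance completeSpace_L20 : CompleteSpace (L20 π) := by
  have hclosed : IsClosed {f : Lp ℝ 2 π | ⟪Lp.const 2 π (1 : ℝ), f⟫_ℝ = 0} :=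
    isClosed_eq (continuous_const.inner continuous_id) continuous_const
  simp only [← mem_L20_iff_inner_const_one] at hclosed
  exact hclosed.completeSpace_coe

lemma norm_pow_apply_le_of_opNorm_le {E : Type*} [SeminormedAddCommGroup E] [NormedSpace ℝ E]
    {T : E →L[ℝ] E} {c : ℝ} (hT : ‖T‖ ≤ c) (n : ℕ) (x : E) : ‖(T ^ n) x‖ ≤ c ^ n * ‖x‖ := by
  induction n with
  | zero => simp
  | succ n ih =>
    rw [pow_succ', mul_apply_eq_comp, pow_succ', mul_assoc]
    exact (T.le_of_opNorm_le hT _).trans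
      (mul_le_mul_of_nonneg_left ih ((norm_nonneg T).trans hT))

lemma coe_markovOp0_pow_apply (hK : K.Invariant π) (n : ℕ) (f : L20 π) :
    ((markovOp0 K π hK ^ n) f : Lp ℝ 2 π) = (markovOp K π hK ^ n) f := by
  induction n with
  | zero => rfl
  | succ n ih =>
    rw [pow_succ', pow_succ', mul_apply_eq_comp, mul_apply_eq_comp, ← ih]
    rfl

lemma norm_markovOp0_pow_apply_le (hK : K.Invariant π) (n : ℕ) (f : L20 π) :
    ‖(markovOp0 K π hK ^ n) f‖ ≤ opNorm0 K π hK ^ n * ‖f‖ :=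
  norm_pow_apply_le_of_opNorm_le le_rfl n f

lemma isSymmetric_markovOp0 (hrev : K.IsReversible π) :
    (markovOp0 K π hrev.invariant : L20 π →ₗ[ℝ] L20 π).IsSymmetric := fun f g =>
  isSymmetric_markovOp hrev (f : Lp ℝ 2 π) g

lemma abs_specSup_le_opNorm0 (hrev : K.IsReversible π) :
    |specSup K π hrev.invariant| ≤ opNorm0 K π hrev.invariant :=
  abs_sSup_spectrum_le_opNorm (isSymmetric_markovOp0 hrev)

lemma neg_norm_sq_le_inner_markovOp0 (hK : K.Invariant π) (f : L20 π) :
    -‖f‖ ^ 2 ≤ ⟪markovOp0 K π hK f, f⟫_ℝ := by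
  have hnorm : ‖markovOp0 K π hK f‖ ≤ ‖f‖ := norm_markovOp_apply_le hK (f : Lp ℝ 2 π)
  have hinner := neg_le_of_abs_le (abs_real_inner_le_norm (markovOp0 K π hK f) f)
  nlinarith [norm_nonneg f]

lemma norm_sq_eq_sq_add_norm_sq (c : ℝ) (g : L20 π) :
    ‖c • Lp.const 2 π (1 : ℝ) + g‖ ^ 2 = c ^ 2 + ‖g‖ ^ 2 := by
  have horth : ⟪c • Lp.const 2 π (1 : ℝ), (g : Lp ℝ 2 π)⟫_ℝ = 0 := by
    rw [inner_smul_left, mem_L20_iff_inner_const_one.1 g.2, mul_zero]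
  rw [norm_add_sq_real, horth, norm_smul, norm_const_one]
  simp

lemma inner_markovOp_const_add (hK : K.Invariant π) (c : ℝ) (g : L20 π) :
    ⟪markovOp K π hK (c • Lp.const 2 π (1 : ℝ) + g), c • Lp.const 2 π (1 : ℝ) + g⟫_ℝ =
      c ^ 2 + ⟪markovOp0 K π hK g, g⟫_ℝ := by
  have horth : ⟪Lp.const 2 π (1 : ℝ), (g : Lp ℝ 2 π)⟫_ℝ = 0 := mem_L20_iff_inner_const_one.1 g.2
  have horthP : ⟪markovOp K π hK g, Lp.const 2 π (1 : ℝ)⟫_ℝ = 0 := by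
    rw [real_inner_comm]
    exact mem_L20_iff_inner_const_one.1 (markovOp_mem_L20 K π hK g g.2)
  rw [map_add, map_smul, markovOp_const, inner_add_left, inner_add_right, inner_add_right,
    inner_smul_left, inner_smul_left, inner_smul_right, inner_smul_right, horth, horthP,
    real_inner_self_eq_norm_sq, norm_const_one, Submodule.coe_inner]
  simp only [conj_trivial, one_pow, mul_one, mul_zero, add_zero, zero_add, ← sq]
  rfl

/-- The one-sided spectral gap of `P` in quadratic form: `P ≤ l • 1 + (1 - l) • Π` on `L₂(π)`,
where `Π f = ∫ f dπ` is the projection onto the constants and `0 ≤ l < 1`. -/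
structure PoincareBound (K : Kernel X X) [IsMarkovKernel K] (π : Measure X)
    [IsProbabilityMeasure π] (hK : K.Invariant π) (l : ℝ) : Prop where
  nonneg : 0 ≤ l
  lt_one : l < 1
  inner_markovOp_le : ∀ f : Lp ℝ 2 π,
    ⟪markovOp K π hK f, f⟫_ℝ ≤ l * ‖f‖ ^ 2 + (1 - l) * (∫ x, f x ∂π) ^ 2

lemma VarianceBounding.poincareBound (hrev : K.IsReversible π)
    (hvb : VarianceBounding K π hrev.invariant) :
    PoincareBound K π hrev.invariant (max 0 (specSup K π hrev.invariant)) where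
  nonneg := le_max_left _ _
  lt_one := max_lt zero_lt_one hvb
  inner_markovOp_le f := by
    obtain ⟨g, hg⟩ : ∃ g : L20 π, f = (∫ x, f x ∂π) • Lp.const 2 π (1 : ℝ) + g :=
      ⟨⟨_, sub_integral_smul_const_one_mem_L20 f⟩, (add_sub_cancel _ f).symm⟩
    set c := ∫ x, f x ∂π
    have hgap : ⟪markovOp0 K π hrev.invariant g, g⟫_ℝ ≤
        max 0 (specSup K π hrev.invariant) * ‖g‖ ^ 2 :=
      (inner_le_sSup_spectrum (isSymmetric_markovOp0 hrev) g).trans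
        (mul_le_mul_of_nonneg_right (le_max_right _ _) (sq_nonneg _))
    rw [hg, inner_markovOp_const_add, norm_sq_eq_sq_add_norm_sq]
    linarith

lemma PoincareBound.inner_markovOp0_le {hK : K.Invariant π} {l : ℝ}
    (hl : PoincareBound K π hK l) (f : L20 π) : ⟪markovOp0 K π hK f, f⟫_ℝ ≤ l * ‖f‖ ^ 2 := by
  have hmean : ∫ x, (f : Lp ℝ 2 π) x ∂π = 0 := f.2
  have hbound := hl.inner_markovOp_le f
  rwa [hmean, zero_pow two_ne_zero, mul_zero, add_zero] at hbound

lemma PoincareBound.norm_sum_markovOp0_pow_le {hK : K.Invariant π} {l : ℝ}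
    (hl : PoincareBound K π hK l) (hrev : K.IsReversible π) (n : ℕ) :
    ‖∑ j ∈ Finset.range n, markovOp0 K π hK ^ j‖ ≤ ∑ j ∈ Finset.range n, l ^ j :=
  norm_geom_sum_le hl.nonneg (isSymmetric_markovOp0 hrev)
    (neg_norm_sq_le_inner_markovOp0 hK) hl.inner_markovOp0_le n

end ReversibleOperator

section Tilt

variable {X : Type*} {A : Set X}

/-- The exponential weight `exp (t 1_A)`, whose product along a trajectory is the exponential of
`t` times the occupation time of `A`. -/
def tilt (A : Set X) (t : ℝ) (x : X) : ℝ :=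
  Real.exp (t * A.indicator 1 x)

lemma tilt_pos (A : Set X) (t : ℝ) (x : X) : 0 < tilt A t x :=
  Real.exp_pos _

lemma tilt_mul_tilt (A : Set X) (s t : ℝ) (x : X) :
    tilt A s x * tilt A t x = tilt A (s + t) x := by
  rw [tilt, tilt, tilt, ← Real.exp_add, add_mul]

variable [MeasurableSpace X]

lemma measurable_tilt (hA : MeasurableSet A) (t : ℝ) : Measurable (tilt A t) :=
  ((measurable_one.indicator hA).const_mul t).exp

lemma memLp_top_tilt (hA : MeasurableSet A) (t : ℝ) (μ : Measure X) : MemLp (tilt A t) ∞ μ := by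
  refine memLp_top_of_bound (measurable_tilt hA t).aestronglyMeasurable (Real.exp |t|)
    (.of_forall fun x => ?_)
  rw [Real.norm_of_nonneg (tilt_pos A t x).le, tilt, Real.exp_le_exp]
  by_cases hx : x ∈ A
  · simpa [hx] using le_abs_self t
  · simp [hx]

lemma integral_tilt_mul {μ : Measure X} (hA : MeasurableSet A) (t : ℝ) {f : X → ℝ}
    (hf : Integrable f μ) :
    ∫ x, tilt A t x * f x ∂μ = Real.exp t * ∫ x in A, f x ∂μ + ∫ x in Aᶜ, f x ∂μ := by
  have hint : Integrable (fun x => tilt A t x * f x) μ :=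
    memLp_one_iff_integrable.1 ((memLp_one_iff_integrable.2 hf).mul (memLp_top_tilt hA t μ))
  rw [← integral_add_compl hA hint, ← integral_const_mul]
  congr 1
  · exact setIntegral_congr_fun hA fun x hx => by simp [tilt, Set.indicator_of_mem hx]
  · exact setIntegral_congr_fun hA.compl fun x hx => by
      simp [tilt, Set.indicator_of_notMem hx]

lemma integral_abs_le_sqrt_mul_sqrt {μ : Measure X} [IsFiniteMeasure μ] {f : X → ℝ}
    (hf : MemLp f 2 μ) :
    ∫ x, |f x| ∂μ ≤ √(μ.real Set.univ) * √(∫ x, f x ^ 2 ∂μ) := by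
  simpa [Real.sqrt_eq_rpow, measureReal_def] using
    integral_mul_le_Lp_mul_Lq_of_nonneg (μ := μ) (f := fun _ => 1) (g := fun x => |f x|)
      Real.HolderConjugate.two_two (.of_forall fun _ => zero_le_one)
      (.of_forall fun x => abs_nonneg (f x)) (memLp_const 1) (by simpa using hf.norm)

lemma tilt_quadratic_form_le {π : Measure X} [IsProbabilityMeasure π] {l : ℝ} (hl₀ : 0 ≤ l)
    (hl₁ : l < 1) (hA : MeasurableSet A) (t : ℝ) {f : X → ℝ} (hf : MemLp f 2 π) :
    l * ∫ x, (tilt A (t / 2) x * f x) ^ 2 ∂π +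
        (1 - l) * (∫ x, |tilt A (t / 2) x * f x| ∂π) ^ 2 ≤
      Real.exp (t * π.real A + varianceFactor l * t ^ 2 / 8) * ∫ x, f x ^ 2 ∂π := by
  have hsq : ∫ x, (tilt A (t / 2) x * f x) ^ 2 ∂π =
      Real.exp t * ∫ x in A, f x ^ 2 ∂π + ∫ x in Aᶜ, f x ^ 2 ∂π := by
    rw [← integral_tilt_mul hA t hf.integrable_sq]
    simp only [mul_pow, sq (tilt _ _ _), tilt_mul_tilt, add_halves]
  have habs : ∫ x, |tilt A (t / 2) x * f x| ∂π =
      Real.exp (t / 2) * ∫ x in A, |f x| ∂π + ∫ x in Aᶜ, |f x| ∂π := by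
    rw [← integral_tilt_mul hA (t / 2) (hf.integrable one_le_two).abs]
    simp only [abs_mul, abs_of_pos (tilt_pos _ _ _)]
  have hcs : ∀ B : Set X,
      ∫ x in B, |f x| ∂π ≤ √(π.real B) * √(∫ x in B, f x ^ 2 ∂π) := fun B => by
    simpa using integral_abs_le_sqrt_mul_sqrt (hf.restrict B)
  have hsum : ∫ x, |tilt A (t / 2) x * f x| ∂π ≤
      Real.exp (t / 2) * √(π.real A) * √(∫ x in A, f x ^ 2 ∂π) +
        √(1 - π.real A) * √(∫ x in Aᶜ, f x ^ 2 ∂π) := by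
    rw [habs, mul_assoc, ← probReal_compl_eq_one_sub hA]
    gcongr
    exacts [hcs A, hcs Aᶜ]
  have hstates := two_state_quadratic_le hl₀ hl₁
    (p := π.real A) ⟨measureReal_nonneg, measureReal_le_one⟩ t
    (√(∫ x in A, f x ^ 2 ∂π)) (√(∫ x in Aᶜ, f x ^ 2 ∂π))
  rw [Real.sq_sqrt (integral_nonneg fun x => sq_nonneg _),
    Real.sq_sqrt (integral_nonneg fun x => sq_nonneg _),
    integral_add_compl hA hf.integrable_sq] at hstates
  rw [hsq]
  refine le_trans ?_ hstates
  gcongr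

end Tilt

section TiltedOperator

open scoped InnerProductSpace

variable {X : Type*} [MeasurableSpace X] {K : Kernel X X} [IsMarkovKernel K] {π : Measure X}
  [IsProbabilityMeasure π] {A : Set X}

/-- Multiplication by `exp (t 1_A)` on `L₂(μ)`. -/
def tiltOp (μ : Measure X) (hA : MeasurableSet A) (t : ℝ) : Lp ℝ 2 μ →L[ℝ] Lp ℝ 2 μ :=
  (ContinuousLinearMap.mul ℝ ℝ).holderL μ ∞ 2 2 (memLp_top_tilt hA t μ).toLp

lemma coeFn_tiltOp {μ : Measure X} (hA : MeasurableSet A) (t : ℝ) (f : Lp ℝ 2 μ) :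
    tiltOp μ hA t f =ᵐ[μ] fun x => tilt A t x * f x := by
  filter_upwards [(ContinuousLinearMap.mul ℝ ℝ).coeFn_holder (r := 2)
    (memLp_top_tilt hA t μ).toLp f, (memLp_top_tilt hA t μ).coeFn_toLp] with x hmul htilt
  rw [← htilt]
  exact hmul

lemma coeFn_tiltOp_const_one {μ : Measure X} [IsFiniteMeasure μ] (hA : MeasurableSet A) (t : ℝ) :
    tiltOp μ hA t (Lp.const 2 μ 1) =ᵐ[μ] tilt A t := by
  filter_upwards [coeFn_tiltOp hA t (Lp.const 2 μ 1), Lp.coeFn_const 2 μ (1 : ℝ)] with x hx hx1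
  rw [hx, hx1, Function.const_apply, mul_one]

lemma isSymmetric_tiltOp {μ : Measure X} (hA : MeasurableSet A) (t : ℝ) :
    (tiltOp μ hA t : Lp ℝ 2 μ →ₗ[ℝ] Lp ℝ 2 μ).IsSymmetric := fun f g => by
  rw [ContinuousLinearMap.coe_coe, L2.inner_def, L2.inner_def]
  refine integral_congr_ae ?_
  filter_upwards [coeFn_tiltOp hA t f, coeFn_tiltOp hA t g] with x hf hg
  simp only [hf, hg, RCLike.inner_apply, conj_trivial]
  ring

lemma norm_sq_eq_integral {μ : Measure X} (f : Lp ℝ 2 μ) : ‖f‖ ^ 2 = ∫ x, f x ^ 2 ∂μ := by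
  rw [← real_inner_self_eq_norm_sq, L2.inner_def]
  simp

lemma inner_markovOp_abs_le (hK : K.Invariant π) (f : Lp ℝ 2 π) :
    |⟪markovOp K π hK f, f⟫_ℝ| ≤ ⟪markovOp K π hK |f|, |f|⟫_ℝ := by
  have habs : ∀ᵐ y ∂(π.bind K), |f| y = |f y| := by rw [hK.def]; exact Lp.coeFn_abs f
  rw [inner_markovOp, inner_markovOp]
  refine (abs_integral_le_integral_abs).trans (integral_mono_ae ?_ ?_ ?_)
  · exact ((Lp.memLp f).integrable_mul (memLp_integral_kernel hK f).1).abs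
  · exact (Lp.memLp |f|).integrable_mul (memLp_integral_kernel hK |f|).1
  · filter_upwards [Lp.coeFn_abs f, Measure.ae_ae_of_ae_comp habs] with x hx hKx
    rw [hx, integral_congr_ae hKx, abs_mul]
    gcongr
    exact abs_integral_le_integral_abs

/-- Passing to `|f|` turns the one-sided gap into a bound on both sides of the form, so that the
bottom of the spectrum plays no role. -/
lemma PoincareBound.abs_inner_markovOp_le {hK : K.Invariant π} {l : ℝ}
    (hl : PoincareBound K π hK l) (f : Lp ℝ 2 π) :
    |⟪markovOp K π hK f, f⟫_ℝ| ≤ l * ‖f‖ ^ 2 + (1 - l) * (∫ x, |f x| ∂π) ^ 2 := by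
  have hbound := hl.inner_markovOp_le |f|
  rw [norm_abs_eq_norm, integral_congr_ae (Lp.coeFn_abs f)] at hbound
  exact (inner_markovOp_abs_le hK f).trans hbound

/-- The symmetrized tilted operator `exp (t 1_A / 2) P exp (t 1_A / 2)`. -/
def tiltedMarkovOp (K : Kernel X X) [IsMarkovKernel K] (π : Measure X) [IsProbabilityMeasure π]
    (hK : K.Invariant π) (hA : MeasurableSet A) (t : ℝ) : Lp ℝ 2 π →L[ℝ] Lp ℝ 2 π :=
  tiltOp π hA (t / 2) ∘L markovOp K π hK ∘L tiltOp π hA (t / 2)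

lemma PoincareBound.norm_tiltedMarkovOp_le {hK : K.Invariant π} {l : ℝ}
    (hl : PoincareBound K π hK l) (hrev : K.IsReversible π) (hA : MeasurableSet A) (t : ℝ) :
    ‖tiltedMarkovOp K π hK hA t‖ ≤
      Real.exp (t * π.real A + varianceFactor l * t ^ 2 / 8) := by
  have hinner : ∀ f g, ⟪tiltedMarkovOp K π hK hA t f, g⟫_ℝ =
      ⟪markovOp K π hK (tiltOp π hA (t / 2) f), tiltOp π hA (t / 2) g⟫_ℝ :=
    fun f g => isSymmetric_tiltOp hA (t / 2) _ g
  refine norm_le_of_forall_abs_inner_le (fun f g => ?_) (Real.exp_nonneg _) fun f => ?_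
  · simp only [ContinuousLinearMap.coe_coe]
    rw [hinner, real_inner_comm _ f, hinner, real_inner_comm]
    exact (isSymmetric_markovOp hrev _ _).symm
  · have htilt := coeFn_tiltOp (μ := π) hA (t / 2) f
    rw [hinner]
    refine (hl.abs_inner_markovOp_le _).trans ?_
    rw [norm_sq_eq_integral, norm_sq_eq_integral f,
      integral_congr_ae (htilt.mono fun x hx => congrArg (· ^ 2) hx),
      integral_congr_ae (htilt.mono fun x hx => congrArg abs hx)]
    exact tilt_quadratic_form_le hl.nonneg hl.lt_one hA t (Lp.memLp f)

end TiltedOperator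

section FeynmanKac

open scoped InnerProductSpace

variable {X : Type*} [MeasurableSpace X]

lemma sq_lintegral_mul_le {μ : Measure X} {f g : X → ℝ≥0∞} (hf : AEMeasurable f μ)
    (hg : AEMeasurable g μ) :
    (∫⁻ x, f x * g x ∂μ) ^ 2 ≤ (∫⁻ x, f x ^ 2 ∂μ) * ∫⁻ x, g x ^ 2 ∂μ := by
  have hcs := ENNReal.lintegral_mul_le_Lp_mul_Lq μ Real.HolderConjugate.two_two hf hg
  simp only [ENNReal.rpow_two, Pi.mul_apply] at hcs
  calc _ ≤ _ := pow_le_pow_left' hcs 2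
    _ = _ := by
      rw [mul_pow, ← ENNReal.rpow_natCast, ← ENNReal.rpow_natCast, ← ENNReal.rpow_mul,
        ← ENNReal.rpow_mul]
      norm_num

lemma sq_lintegral_le {μ : Measure X} [IsProbabilityMeasure μ] {f : X → ℝ≥0∞}
    (hf : AEMeasurable f μ) : (∫⁻ x, f x ∂μ) ^ 2 ≤ ∫⁻ x, f x ^ 2 ∂μ := by
  simpa using sq_lintegral_mul_le hf (aemeasurable_const (b := 1))

/-- The Feynman–Kac operator `h ↦ P (F h)` with potential `F ≥ 0`; its `k`-th iterate at `1` is the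
conditional expectation of the product of `F` along the next `k` states of the chain. -/
def feynmanKac (K : Kernel X X) (F h : X → ℝ≥0∞) (x : X) : ℝ≥0∞ :=
  ∫⁻ y, F y * h y ∂K x

lemma measurable_feynmanKac (K : Kernel X X) {F h : X → ℝ≥0∞} (hF : Measurable F)
    (hh : Measurable h) : Measurable (feynmanKac K F h) :=
  (hF.mul hh).lintegral_kernel

lemma measurable_feynmanKac_iterate (K : Kernel X X) {F : X → ℝ≥0∞} (hF : Measurable F) (k : ℕ) :
    Measurable ((feynmanKac K F)^[k] 1) := by
  induction k with
  | zero => exact measurable_one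
  | succ k ih =>
    rw [Function.iterate_succ_apply']
    exact measurable_feynmanKac K hF ih

lemma feynmanKac_iterate_sq_le (K : Kernel X X) [IsMarkovKernel K] {F : X → ℝ≥0∞}
    (hF : Measurable F) (k : ℕ) (x : X) :
    (feynmanKac K F)^[k] 1 x ^ 2 ≤ (feynmanKac K fun y => F y ^ 2)^[k] 1 x := by
  induction k generalizing x with
  | zero => simp
  | succ k ih =>
    rw [Function.iterate_succ_apply', Function.iterate_succ_apply']
    calc _ ≤ ∫⁻ y, (F y * (feynmanKac K F)^[k] 1 y) ^ 2 ∂K x :=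
          sq_lintegral_le (hF.mul (measurable_feynmanKac_iterate K hF k)).aemeasurable
      _ ≤ _ := lintegral_mono fun y => by
          rw [mul_pow]
          exact mul_le_mul_right (ih y) _

variable {K : Kernel X X} [IsMarkovKernel K] {π : Measure X} [IsProbabilityMeasure π] {A : Set X}

lemma markovOp_nonneg (hK : K.Invariant π) {f : Lp ℝ 2 π} (hf : 0 ≤ᵐ[π] f) :
    0 ≤ᵐ[π] markovOp K π hK f := by
  have hbind : ∀ᵐ y ∂(π.bind K), 0 ≤ f y := by rwa [hK.def]
  filter_upwards [markovOp_coeFn K π hK f, Measure.ae_ae_of_ae_comp hbind] with x hP hx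
  rw [hP]
  exact integral_nonneg_of_ae hx

lemma tiltOp_nonneg {μ : Measure X} (hA : MeasurableSet A) (t : ℝ) {f : Lp ℝ 2 μ}
    (hf : 0 ≤ᵐ[μ] f) : 0 ≤ᵐ[μ] tiltOp μ hA t f := by
  filter_upwards [coeFn_tiltOp hA t f, hf] with x hx hfx
  rw [hx]
  exact mul_nonneg (tilt_pos A t x).le hfx

/-- The potential `exp (t 1_A)` as a function with values in `[0, ∞]`. -/
def etilt (A : Set X) (t : ℝ) (x : X) : ℝ≥0∞ :=
  ENNReal.ofReal (tilt A t x)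

lemma measurable_etilt (hA : MeasurableSet A) (t : ℝ) : Measurable (etilt A t) :=
  (measurable_tilt hA t).ennreal_ofReal

omit [MeasurableSpace X] in
lemma etilt_mul_etilt (A : Set X) (s t : ℝ) (x : X) :
    etilt A s x * etilt A t x = etilt A (s + t) x := by
  rw [etilt, etilt, etilt, ← ENNReal.ofReal_mul (tilt_pos A s x).le, tilt_mul_tilt]

lemma ofReal_tiltOp_ae_eq {μ : Measure X} (hA : MeasurableSet A) (t : ℝ) (f : Lp ℝ 2 μ) :
    (fun x => ENNReal.ofReal (tiltOp μ hA t f x)) =ᵐ[μ]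
      fun x => etilt A t x * ENNReal.ofReal (f x) := by
  filter_upwards [coeFn_tiltOp hA t f] with x hx
  rw [hx, ENNReal.ofReal_mul (tilt_pos A t x).le, etilt]

lemma tiltedMarkovOp_nonneg (hK : K.Invariant π) (hA : MeasurableSet A) (t : ℝ) {f : Lp ℝ 2 π}
    (hf : 0 ≤ᵐ[π] f) : 0 ≤ᵐ[π] tiltedMarkovOp K π hK hA t f :=
  tiltOp_nonneg hA _ (markovOp_nonneg hK (tiltOp_nonneg hA _ hf))

lemma ofReal_tiltedMarkovOp_ae_eq (hK : K.Invariant π) (hA : MeasurableSet A) (t : ℝ)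
    {f : Lp ℝ 2 π} (hf : 0 ≤ᵐ[π] f) {h : X → ℝ≥0∞}
    (hfh : (fun x => ENNReal.ofReal (f x)) =ᵐ[π] fun x => etilt A (t / 2) x * h x) :
    (fun x => ENNReal.ofReal (tiltedMarkovOp K π hK hA t f x)) =ᵐ[π]
      fun x => etilt A (t / 2) x * feynmanKac K (etilt A t) h x := by
  have hinner : ∀ᵐ y ∂(π.bind K),
      ENNReal.ofReal (tiltOp π hA (t / 2) f y) = etilt A t y * h y := by
    rw [hK.def]
    filter_upwards [ofReal_tiltOp_ae_eq hA (t / 2) f, hfh] with y hy hfy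
    rw [hy, hfy, ← mul_assoc, etilt_mul_etilt, add_halves]
  filter_upwards [ofReal_tiltOp_ae_eq hA (t / 2) (markovOp K π hK (tiltOp π hA (t / 2) f)),
    ofReal_markovOp_ae_eq_lintegral hK (tiltOp_nonneg hA (t / 2) hf),
    Measure.ae_ae_of_ae_comp hinner] with x houter hP hKx
  rw [feynmanKac, ← lintegral_congr_ae hKx, ← hP]
  exact houter

lemma tiltedMarkovOp_pow_nonneg_and_ofReal_ae_eq (hK : K.Invariant π) (hA : MeasurableSet A)
    (t : ℝ) (k : ℕ) :
    0 ≤ᵐ[π] (tiltedMarkovOp K π hK hA t ^ k) (tiltOp π hA (t / 2) (Lp.const 2 π 1)) ∧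
      (fun x => ENNReal.ofReal
        ((tiltedMarkovOp K π hK hA t ^ k) (tiltOp π hA (t / 2) (Lp.const 2 π 1)) x)) =ᵐ[π]
        fun x => etilt A (t / 2) x * (feynmanKac K (etilt A t))^[k] 1 x := by
  induction k with
  | zero =>
    have hone := coeFn_tiltOp_const_one (μ := π) hA (t / 2)
    refine ⟨hone.mono fun x hx => ?_, hone.mono fun x hx => ?_⟩
    · exact (tilt_pos A (t / 2) x).le.trans_eq hx.symm
    · simp [hx, etilt]
  | succ k ih =>
    rw [pow_succ', Function.iterate_succ_apply']
    exact ⟨tiltedMarkovOp_nonneg hK hA t ih.1, ofReal_tiltedMarkovOp_ae_eq hK hA t ih.1 ih.2⟩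

lemma norm_sq_tiltOp_const_one_le {l : ℝ} (hl₀ : 0 ≤ l) (hl₁ : l < 1) (hA : MeasurableSet A)
    (t : ℝ) :
    ‖tiltOp π hA (t / 2) (Lp.const 2 π 1)‖ ^ 2 ≤
      Real.exp (t * π.real A + varianceFactor l * t ^ 2 / 8) := by
  have hsq : (fun x => tiltOp π hA (t / 2) (Lp.const 2 π 1) x ^ 2) =ᵐ[π] tilt A t := by
    filter_upwards [coeFn_tiltOp_const_one hA (t / 2)] with x hx
    rw [hx, sq, tilt_mul_tilt, add_halves]
  rw [norm_sq_eq_integral, integral_congr_ae hsq]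
  refine (integral_exp_mul_indicator_le π hA t).trans (Real.exp_le_exp.2 ?_)
  have hfactor := le_mul_of_one_le_left (sq_nonneg t) (one_le_varianceFactor hl₀ hl₁)
  linarith

lemma lintegral_etilt_mul_feynmanKac_iterate (hK : K.Invariant π) (hA : MeasurableSet A) (t : ℝ)
    (k : ℕ) :
    ∫⁻ x, etilt A t x * (feynmanKac K (etilt A t))^[k] 1 x ∂π =
      ENNReal.ofReal ⟪(tiltedMarkovOp K π hK hA t ^ k) (tiltOp π hA (t / 2) (Lp.const 2 π 1)),
        tiltOp π hA (t / 2) (Lp.const 2 π 1)⟫_ℝ := by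
  have hone := coeFn_tiltOp_const_one (μ := π) hA (t / 2)
  obtain ⟨hnonneg, hofReal⟩ := tiltedMarkovOp_pow_nonneg_and_ofReal_ae_eq hK hA t k
  set w := tiltOp π hA (t / 2) (Lp.const 2 π 1)
  set w' := (tiltedMarkovOp K π hK hA t ^ k) w
  rw [L2.inner_def, ofReal_integral_eq_lintegral_ofReal (L2.integrable_inner _ _)]
  · refine lintegral_congr_ae ?_
    filter_upwards [hofReal, hone] with x hw' hw
    rw [RCLike.inner_apply, conj_trivial, hw, ENNReal.ofReal_mul (tilt_pos A (t / 2) x).le, hw',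
      ← etilt, ← mul_assoc, etilt_mul_etilt, add_halves]
  · filter_upwards [hnonneg, hone] with x hx hw
    rw [RCLike.inner_apply, conj_trivial, hw]
    exact mul_nonneg (tilt_pos A (t / 2) x).le hx

lemma PoincareBound.lintegral_etilt_mul_feynmanKac_iterate_le {hK : K.Invariant π} {l : ℝ}
    (hl : PoincareBound K π hK l) (hrev : K.IsReversible π) (hA : MeasurableSet A) (t : ℝ) (k : ℕ) :
    ∫⁻ x, etilt A t x * (feynmanKac K (etilt A t))^[k] 1 x ∂π ≤
      ENNReal.ofReal (Real.exp (t * π.real A + varianceFactor l * t ^ 2 / 8) ^ (k + 1)) := by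
  rw [lintegral_etilt_mul_feynmanKac_iterate hK hA]
  refine ENNReal.ofReal_le_ofReal ?_
  set w := tiltOp π hA (t / 2) (Lp.const 2 π 1)
  set T := tiltedMarkovOp K π hK hA t
  set Θ := Real.exp (t * π.real A + varianceFactor l * t ^ 2 / 8)
  have hpow : ‖(T ^ k) w‖ ≤ Θ ^ k * ‖w‖ :=
    norm_pow_apply_le_of_opNorm_le (hl.norm_tiltedMarkovOp_le hrev hA t) k w
  calc ⟪(T ^ k) w, w⟫_ℝ ≤ ‖(T ^ k) w‖ * ‖w‖ := real_inner_le_norm _ _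
    _ ≤ Θ ^ k * ‖w‖ * ‖w‖ := by gcongr
    _ = Θ ^ k * ‖w‖ ^ 2 := by ring
    _ ≤ Θ ^ k * Θ := by
        gcongr
        exact norm_sq_tiltOp_const_one_le hl.nonneg hl.lt_one hA t
    _ = Θ ^ (k + 1) := (pow_succ _ _).symm

lemma lintegral_ofReal_sq_le {μ : Measure X} (f : Lp ℝ 2 μ) :
    ∫⁻ x, ENNReal.ofReal (f x) ^ 2 ∂μ ≤ ENNReal.ofReal (‖f‖ ^ 2) := by
  rw [norm_sq_eq_integral, ofReal_integral_eq_lintegral_ofReal (Lp.memLp f).integrable_sq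
    (.of_forall fun x => sq_nonneg _)]
  refine lintegral_mono fun x => ?_
  rw [← sq_abs (f x), ENNReal.ofReal_pow (abs_nonneg _)]
  gcongr
  exact le_abs_self _

lemma sq_lintegral_withDensity_etilt_mul_feynmanKac_iterate_le {μ : Measure X}
    (hA : MeasurableSet A) (f : Lp ℝ 2 μ) (t : ℝ) (k : ℕ) :
    (∫⁻ x, etilt A t x * (feynmanKac K (etilt A t))^[k] 1 x
        ∂μ.withDensity (fun x => ENNReal.ofReal (f x))) ^ 2 ≤
      ENNReal.ofReal (‖f‖ ^ 2) *
        ∫⁻ x, etilt A (2 * t) x * (feynmanKac K (etilt A (2 * t)))^[k] 1 x ∂μ := by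
  have hf : Measurable fun x => ENNReal.ofReal (f x) :=
    (Lp.stronglyMeasurable f).measurable.ennreal_ofReal
  have hmeas : Measurable fun x => etilt A t x * (feynmanKac K (etilt A t))^[k] 1 x :=
    (measurable_etilt hA t).mul (measurable_feynmanKac_iterate K (measurable_etilt hA t) k)
  have hsq : (fun x => etilt A t x ^ 2) = etilt A (2 * t) := by
    ext x; rw [sq, etilt_mul_etilt, two_mul]
  rw [lintegral_withDensity_eq_lintegral_mul _ hf hmeas]
  refine (sq_lintegral_mul_le hf.aemeasurable hmeas.aemeasurable).trans
    (mul_le_mul' (lintegral_ofReal_sq_le f) (lintegral_mono fun x => ?_))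
  rw [mul_pow, ← hsq]
  exact mul_le_mul_right (feynmanKac_iterate_sq_le K (measurable_etilt hA t) k x) _

lemma PoincareBound.lintegral_withDensity_etilt_mul_feynmanKac_iterate_le
    {hK : K.Invariant π} {l : ℝ} (hl : PoincareBound K π hK l)
    (hrev : K.IsReversible π) (hA : MeasurableSet A) (f : Lp ℝ 2 π) (t : ℝ) (k : ℕ) :
    ∫⁻ x, etilt A t x * (feynmanKac K (etilt A t))^[k] 1 x
        ∂π.withDensity (fun x => ENNReal.ofReal (f x)) ≤
      ENNReal.ofReal (‖f‖ *
        Real.exp ((k + 1) * (t * π.real A + varianceFactor l * t ^ 2 / 4))) := by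
  have hexp : Real.exp (2 * t * π.real A + varianceFactor l * (2 * t) ^ 2 / 8) ^ (k + 1) =
      Real.exp ((k + 1) * (t * π.real A + varianceFactor l * t ^ 2 / 4)) ^ 2 := by
    rw [← Real.exp_nat_mul, ← Real.exp_nat_mul]
    congr 1
    push_cast
    ring
  refine (ENNReal.pow_le_pow_left_iff two_ne_zero).1 ?_
  rw [← ENNReal.ofReal_pow (by positivity), mul_pow, ENNReal.ofReal_mul (sq_nonneg _), ← hexp]
  exact (sq_lintegral_withDensity_etilt_mul_feynmanKac_iterate_le hA f t k).trans
    (mul_le_mul_right (hl.lintegral_etilt_mul_feynmanKac_iterate_le hrev hA (2 * t) k) _)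

end FeynmanKac

section Densities

open scoped InnerProductSpace

variable {X : Type*} [MeasurableSpace X] {K : Kernel X X} [IsMarkovKernel K] {π : Measure X}

instance isProbabilityMeasure_iterMeasure {ν : Measure X} [IsProbabilityMeasure ν] (k : ℕ) :
    IsProbabilityMeasure (iterMeasure K ν k) := by
  induction k with
  | zero => assumption
  | succ k ih =>
    rw [iterMeasure] at ih ⊢
    rw [Function.iterate_succ_apply']
    infer_instance

/-- `f ∈ L₂(π)` is nonnegative and represents the density `dμ/dπ`. Working with the element `f`
of the Hilbert space instead of the function `dμ/dπ` lets the Markov operator act on densities. -/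
structure IsL2DensityOf (f : Lp ℝ 2 π) (μ : Measure X) : Prop where
  nonneg : 0 ≤ᵐ[π] f
  eq_withDensity : μ = π.withDensity fun x => ENNReal.ofReal (f x)

lemma IsL2DensityOf.measureReal_eq_setIntegral {f : Lp ℝ 2 π} {μ : Measure X}
    (h : IsL2DensityOf f μ) {A : Set X} (hA : MeasurableSet A) : μ.real A = ∫ x in A, f x ∂π := by
  rw [Measure.real, h.eq_withDensity, withDensity_apply _ hA,
    integral_eq_lintegral_of_nonneg_ae (ae_restrict_of_ae h.nonneg)
      (Lp.aestronglyMeasurable f).restrict]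

variable [IsProbabilityMeasure π]

lemma bind_withDensity (hrev : K.IsReversible π) {ρ : X → ℝ≥0∞} (hρ : Measurable ρ) :
    (π.withDensity ρ).bind K = π.withDensity fun x => ∫⁻ y, ρ y ∂K x := by
  ext A hA
  calc (π.withDensity ρ).bind K A
      = ∫⁻ x, ∫⁻ _ in A, ρ x ∂K x ∂π := by
        rw [Measure.bind_apply hA K.aemeasurable,
          lintegral_withDensity_eq_lintegral_mul _ hρ (K.measurable_coe hA)]
        simp
    _ = ∫⁻ p in Set.univ ×ˢ A, ρ p.1 ∂(π ⊗ₘ K) := by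
        rw [Measure.setLIntegral_compProd (by fun_prop) .univ hA, setLIntegral_univ]
    _ = ∫⁻ p in A ×ˢ Set.univ, ρ p.2 ∂(π ⊗ₘ K) := by
        conv_lhs => rw [← map_swap_compProd_of_isReversible hrev,
          setLIntegral_map (MeasurableSet.univ.prod hA) (by fun_prop) measurable_swap,
          Set.preimage_swap_prod]
        rfl
    _ = π.withDensity (fun x => ∫⁻ y, ρ y ∂K x) A := by
        rw [Measure.setLIntegral_compProd (by fun_prop) hA .univ, withDensity_apply _ hA]
        simp only [setLIntegral_univ]

lemma HasL2Density.isL2DensityOf {ν : Measure X} [IsFiniteMeasure ν] (h : HasL2Density ν π) :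
    IsL2DensityOf (h.2.toLp _) ν where
  nonneg := by
    filter_upwards [h.2.coeFn_toLp] with x hx
    rw [hx]
    exact ENNReal.toReal_nonneg
  eq_withDensity := by
    refine (Measure.withDensity_rnDeriv_eq ν π h.1).symm.trans (withDensity_congr_ae ?_)
    filter_upwards [h.2.coeFn_toLp, Measure.rnDeriv_lt_top ν π] with x hx hfin
    rw [hx, ENNReal.ofReal_toReal hfin.ne]

namespace IsL2DensityOf

variable {f : Lp ℝ 2 π} {μ : Measure X}

lemma toReal_rnDeriv_ae_eq (h : IsL2DensityOf f μ) :
    (fun x => (μ.rnDeriv π x).toReal) =ᵐ[π] f := by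
  have hrn := Measure.rnDeriv_withDensity π (Lp.stronglyMeasurable f).measurable.ennreal_ofReal
  rw [← h.eq_withDensity] at hrn
  filter_upwards [hrn, h.nonneg] with x hx hnonneg
  rw [hx, ENNReal.toReal_ofReal hnonneg]

lemma hasL2Density (h : IsL2DensityOf f μ) : HasL2Density μ π :=
  ⟨h.eq_withDensity ▸ withDensity_absolutelyContinuous _ _,
    (memLp_congr_ae h.toReal_rnDeriv_ae_eq).2 (Lp.memLp f)⟩

lemma densityNorm_eq (h : IsL2DensityOf f μ) : densityNorm μ π = ‖f‖ := by
  rw [densityNorm, eLpNorm_congr_ae h.toReal_rnDeriv_ae_eq, Lp.norm_def]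

lemma densitySubOneNorm_eq (h : IsL2DensityOf f μ) :
    densitySubOneNorm μ π = ‖f - Lp.const 2 π (1 : ℝ)‖ := by
  rw [densitySubOneNorm, Lp.norm_def]
  congr 1
  refine eLpNorm_congr_ae ?_
  filter_upwards [h.toReal_rnDeriv_ae_eq, Lp.coeFn_sub f (Lp.const 2 π (1 : ℝ)),
    Lp.coeFn_const 2 π (1 : ℝ)] with x hrn hsub hone
  rw [hrn, hsub, Pi.sub_apply, hone, Function.const_apply]

lemma inner_const_one_eq_one [IsProbabilityMeasure μ] (h : IsL2DensityOf f μ) :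
    ⟪Lp.const 2 π (1 : ℝ), f⟫_ℝ = 1 := by
  rw [inner_const_one, ← setIntegral_univ, ← h.measureReal_eq_setIntegral .univ, probReal_univ]

lemma one_le_norm [IsProbabilityMeasure μ] (h : IsL2DensityOf f μ) : 1 ≤ ‖f‖ := by
  simpa [h.inner_const_one_eq_one, norm_const_one] using
    real_inner_le_norm (Lp.const 2 π (1 : ℝ)) f

lemma sub_const_one_mem_L20 [IsProbabilityMeasure μ] (h : IsL2DensityOf f μ) :
    f - Lp.const 2 π (1 : ℝ) ∈ L20 π := by
  rw [mem_L20_iff_inner_const_one, inner_sub_right, h.inner_const_one_eq_one,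
    real_inner_self_eq_norm_sq, norm_const_one]
  norm_num

lemma bind (hrev : K.IsReversible π) (h : IsL2DensityOf f μ) :
    IsL2DensityOf (markovOp K π hrev.invariant f) (μ.bind K) where
  nonneg := markovOp_nonneg hrev.invariant h.nonneg
  eq_withDensity := by
    rw [h.eq_withDensity, bind_withDensity hrev
      (Lp.stronglyMeasurable f).measurable.ennreal_ofReal]
    exact withDensity_congr_ae (ofReal_markovOp_ae_eq_lintegral hrev.invariant h.nonneg).symm

lemma iterMeasure (hrev : K.IsReversible π) (h : IsL2DensityOf f μ) (k : ℕ) :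
    IsL2DensityOf ((markovOp K π hrev.invariant ^ k) f) (iterMeasure K μ k) := by
  induction k with
  | zero => exact h
  | succ k ih =>
    rw [pow_succ', mul_apply_eq_comp, MCQMC.iterMeasure, Function.iterate_succ_apply']
    exact ih.bind hrev

end IsL2DensityOf

lemma markovOp_pow_apply_const (hK : K.Invariant π) (c : ℝ) (k : ℕ) :
    (markovOp K π hK ^ k) (Lp.const 2 π c) = Lp.const 2 π c := by
  induction k with
  | zero => rfl
  | succ k ih => rw [pow_succ', mul_apply_eq_comp, ih, markovOp_const]

lemma markovOp_pow_apply_eq_const_one_add (hK : K.Invariant π) {f : Lp ℝ 2 π}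
    (hf : f - Lp.const 2 π (1 : ℝ) ∈ L20 π) (k : ℕ) :
    (markovOp K π hK ^ k) f = Lp.const 2 π (1 : ℝ) + ((markovOp0 K π hK ^ k) ⟨_, hf⟩ : L20 π) := by
  rw [coe_markovOp0_pow_apply, map_sub, markovOp_pow_apply_const, add_sub_cancel]

lemma densityNorm_iterMeasure_le (hrev : K.IsReversible π) {ν : Measure X}
    [IsProbabilityMeasure ν] (hν : HasL2Density ν π) (k : ℕ) :
    densityNorm (iterMeasure K ν k) π ≤
      1 + opNorm0 K π hrev.invariant ^ k * densitySubOneNorm ν π := by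
  have hdens := hν.isL2DensityOf
  rw [(hdens.iterMeasure hrev k).densityNorm_eq, hdens.densitySubOneNorm_eq,
    markovOp_pow_apply_eq_const_one_add hrev.invariant hdens.sub_const_one_mem_L20]
  exact (norm_add_le _ _).trans (add_le_add norm_const_one.le
    (norm_markovOp0_pow_apply_le hrev.invariant k _))

lemma IsL2DensityOf.measureReal_iterMeasure_sub_eq_inner (hrev : K.IsReversible π) {f : Lp ℝ 2 π}
    {μ : Measure X} [IsProbabilityMeasure μ] (h : IsL2DensityOf f μ) {A : Set X}
    (hA : MeasurableSet A) (k : ℕ) :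
    (MCQMC.iterMeasure K μ k).real A - π.real A =
      ⟪indicatorConstLp 2 hA (measure_ne_top π A) (1 : ℝ),
        ((markovOp0 K π hrev.invariant ^ k) ⟨_, h.sub_const_one_mem_L20⟩ : L20 π)⟫_ℝ := by
  have hone : ⟪indicatorConstLp 2 hA (measure_ne_top π A) (1 : ℝ), Lp.const 2 π (1 : ℝ)⟫_ℝ =
      π.real A := by
    rw [real_inner_comm, inner_const_one, integral_indicatorConstLp, smul_eq_mul, mul_one]
  rw [(h.iterMeasure hrev k).measureReal_eq_setIntegral hA,
    ← L2.inner_indicatorConstLp_one hA (measure_ne_top π A),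
    markovOp_pow_apply_eq_const_one_add hrev.invariant h.sub_const_one_mem_L20, inner_add_right,
    hone, add_sub_cancel_left]

lemma norm_indicatorConstLp_one_le_one {A : Set X} (hA : MeasurableSet A) :
    ‖indicatorConstLp 2 hA (measure_ne_top π A) (1 : ℝ)‖ ≤ 1 := by
  refine norm_indicatorConstLp_le.trans ?_
  rw [norm_one, one_mul]
  exact Real.rpow_le_one measureReal_nonneg measureReal_le_one (by positivity)

lemma PoincareBound.abs_sum_iterMeasure_sub_le {hK : K.Invariant π} {l : ℝ}
    (hl : PoincareBound K π hK l) (hrev : K.IsReversible π) {ν : Measure X}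
    [IsProbabilityMeasure ν] (hν : HasL2Density ν π) {A : Set X} (hA : MeasurableSet A)
    (n₀ n : ℕ) :
    |∑ j ∈ Finset.range n, ((iterMeasure K ν (n₀ + j)).real A - π.real A)| ≤
      (∑ j ∈ Finset.range n, l ^ j) * (opNorm0 K π hK ^ n₀ * densitySubOneNorm ν π) := by
  have hdens := hν.isL2DensityOf
  set g : L20 π := ⟨_, hdens.sub_const_one_mem_L20⟩
  set T := markovOp0 K π hK
  have hsum : ∑ j ∈ Finset.range n, ((iterMeasure K ν (n₀ + j)).real A - π.real A) =
      ⟪indicatorConstLp 2 hA (measure_ne_top π A) (1 : ℝ),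
        ((∑ j ∈ Finset.range n, T ^ j) ((T ^ n₀) g) : L20 π)⟫_ℝ := by
    rw [sum_apply, Submodule.coe_sum, inner_sum]
    refine Finset.sum_congr rfl fun j _ => ?_
    rw [hdens.measureReal_iterMeasure_sub_eq_inner hrev hA, add_comm n₀ j, pow_add,
      mul_apply_eq_comp]
  rw [hsum, hdens.densitySubOneNorm_eq]
  calc _ ≤ ‖indicatorConstLp 2 hA (measure_ne_top π A) (1 : ℝ)‖ *
          ‖(∑ j ∈ Finset.range n, T ^ j) ((T ^ n₀) g)‖ := abs_real_inner_le_norm _ _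
    _ ≤ ‖(∑ j ∈ Finset.range n, T ^ j) ((T ^ n₀) g)‖ :=
        mul_le_of_le_one_left (norm_nonneg _) (norm_indicatorConstLp_one_le_one hA)
    _ ≤ (∑ j ∈ Finset.range n, l ^ j) * ‖(T ^ n₀) g‖ :=
        ContinuousLinearMap.le_of_opNorm_le _ (hl.norm_sum_markovOp0_pow_le hrev n) _
    _ ≤ (∑ j ∈ Finset.range n, l ^ j) * (opNorm0 K π hK ^ n₀ * ‖g‖) :=
        mul_le_mul_of_nonneg_left (norm_markovOp0_pow_apply_le hK n₀ g)
          (Finset.sum_nonneg fun j _ => pow_nonneg hl.nonneg j)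

lemma HasL2Density.one_le_densityNorm {μ : Measure X} [IsProbabilityMeasure μ]
    (hμ : HasL2Density μ π) : 1 ≤ densityNorm μ π :=
  hμ.isL2DensityOf.densityNorm_eq ▸ hμ.isL2DensityOf.one_le_norm

end Densities

section Chain

lemma lintegral_fin_succ_eq_lintegral_lintegral {Ω : Type*} [MeasureSpace Ω]
    [SigmaFinite (volume : Measure Ω)] {N : ℕ} {H : (Fin N → Ω) × Ω → ℝ≥0∞} (hH : Measurable H) :
    ∫⁻ u : Fin (N + 1) → Ω, H (Fin.init u, u (Fin.last N)) = ∫⁻ v, ∫⁻ w, H (v, w) := by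
  have hmp := volume_preserving_piFinSuccAbove (fun _ : Fin (N + 1) => Ω) (Fin.last N)
  have hsplit (u : Fin (N + 1) → Ω) : H (Fin.init u, u (Fin.last N)) =
      (H ∘ Prod.swap) (MeasurableEquiv.piFinSuccAbove (fun _ => Ω) (Fin.last N) u) := by
    rw [Function.comp_apply, MeasurableEquiv.piFinSuccAbove_apply]
    congr 2
    ext j : 1
    simp [Fin.init, Fin.insertNthEquiv]
  simp only [hsplit]
  rw [hmp.lintegral_comp (hH.comp measurable_swap), Measure.volume_eq_prod,
    lintegral_prod_symm _ (hH.comp measurable_swap).aemeasurable]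
  rfl

variable {X : Type*} [MeasurableSpace X] {s : ℕ} {φ : X → Cube s → X} {ψ : Cube s → X}
  {K : Kernel X X} {ν : Measure X}

lemma measurable_chainState (hφ : Measurable fun p : X × Cube s => φ p.1 p.2)
    (hψ : Measurable ψ) (i : ℕ) : Measurable (chainState φ ψ i) := by
  induction i with
  | zero => exact hψ.comp (measurable_pi_apply 0)
  | succ i ih =>
    have hinit : Measurable fun u : Fin (i + 2) → Cube s => Fin.init (n := i + 1) u :=
      measurable_pi_lambda _ fun j => measurable_pi_apply _
    exact hφ.comp ((ih.comp hinit).prodMk (measurable_pi_apply (Fin.last (i + 1))))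

lemma measurable_burnInPoints (hφ : Measurable fun p : X × Cube s => φ p.1 p.2)
    (hψ : Measurable ψ) (n₀ n : ℕ) (j : Fin n) :
    Measurable fun u => burnInPoints φ ψ n₀ n u j :=
  (measurable_chainState hφ hψ _).comp
    (measurable_pi_lambda _ fun _ => measurable_pi_apply _)

lemma IsUpdateFunction.measurePreserving (hφ : IsUpdateFunction φ K) (x : X) :
    MeasurePreserving (φ x) volume (K x) := by
  have hmeas : Measurable (φ x) := hφ.1.comp measurable_prodMk_left
  refine ⟨hmeas, Measure.ext fun A hA => ?_⟩
  rw [Measure.map_apply hmeas hA, hφ.2 x A hA]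
  rfl

lemma IsGeneratorFunction.measurePreserving (hψ : IsGeneratorFunction ψ ν) :
    MeasurePreserving ψ volume ν := by
  refine ⟨hψ.1, Measure.ext fun A hA => ?_⟩
  rw [Measure.map_apply hψ.1 hA, hψ.2 A hA]
  rfl

lemma lintegral_mul_chainState_succ (hφ : IsUpdateFunction φ K) (hψ : Measurable ψ) (i : ℕ)
    {H : (Fin (i + 1) → Cube s) → ℝ≥0∞} (hH : Measurable H) {g : X → ℝ≥0∞} (hg : Measurable g) :
    ∫⁻ u : Fin (i + 2) → Cube s, H (Fin.init u) * g (chainState φ ψ (i + 1) u) =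
      ∫⁻ v, H v * ∫⁻ y, g y ∂K (chainState φ ψ i v) := by
  have hstep : Measurable fun p : (Fin (i + 1) → Cube s) × Cube s =>
      φ (chainState φ ψ i p.1) p.2 :=
    hφ.1.comp (((measurable_chainState hφ.1 hψ i).comp measurable_fst).prodMk measurable_snd)
  refine (lintegral_fin_succ_eq_lintegral_lintegral
    ((hH.comp measurable_fst).mul (hg.comp hstep))).trans (lintegral_congr fun v => ?_)
  have hnext := hφ.measurePreserving (chainState φ ψ i v)
  rw [← hnext.lintegral_comp hg]
  exact lintegral_const_mul (H v) (f := g ∘ φ (chainState φ ψ i v)) (hg.comp hnext.measurable)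

lemma lintegral_chainState (hφ : IsUpdateFunction φ K) (hψ : IsGeneratorFunction ψ ν) (i : ℕ)
    {g : X → ℝ≥0∞} (hg : Measurable g) :
    ∫⁻ u, g (chainState φ ψ i u) = ∫⁻ x, g x ∂iterMeasure K ν i := by
  induction i generalizing g with
  | zero =>
    exact (hψ.measurePreserving.comp
      (measurePreserving_eval (fun _ : Fin 1 => volume) 0)).lintegral_comp hg
  | succ i ih =>
    have hstep := lintegral_mul_chainState_succ hφ hψ.1 i (H := 1) measurable_one hg
    simp only [Pi.one_apply, one_mul] at hstep
    rw [hstep, ih hg.lintegral_kernel, iterMeasure, iterMeasure, Function.iterate_succ_apply',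
      Measure.lintegral_bind K.aemeasurable hg.aemeasurable]

lemma volume_pullBack (hφ : IsUpdateFunction φ K) (hψ : IsGeneratorFunction ψ ν) (i : ℕ)
    {A : Set X} (hA : MeasurableSet A) :
    volume (pullBack φ ψ i A) = iterMeasure K ν i A := by
  rw [← lintegral_indicator_one hA,
    ← lintegral_chainState hφ hψ i (measurable_one.indicator hA),
    ← lintegral_indicator_one (s := pullBack φ ψ i A) (measurable_chainState hφ.1 hψ.1 i hA)]
  rfl

lemma lintegral_prod_mul_burnInPoints (hφ : IsUpdateFunction φ K) (hψ : IsGeneratorFunction ψ ν)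
    {F : X → ℝ≥0∞} (hF : Measurable F) (n₀ n : ℕ) {g : X → ℝ≥0∞} (hg : Measurable g) :
    ∫⁻ u : Fin (n₀ + (n + 1)) → Cube s, (∏ j, F (burnInPoints φ ψ n₀ (n + 1) u j)) *
        g (chainState φ ψ (n₀ + n) u) =
      ∫⁻ x, F x * (feynmanKac K F)^[n] g x ∂iterMeasure K ν n₀ := by
  induction n generalizing g with
  | zero =>
    simp only [Fin.prod_univ_castSucc, Finset.univ_eq_empty, Finset.prod_empty, one_mul]
    exact lintegral_chainState hφ hψ n₀ (hF.mul hg)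
  | succ n ih =>
    have hprod : Measurable fun v : Fin (n₀ + (n + 1)) → Cube s =>
        ∏ j, F (burnInPoints φ ψ n₀ (n + 1) v j) :=
      Finset.measurable_prod _ fun j _ => hF.comp (measurable_burnInPoints hφ.1 hψ.1 n₀ (n + 1) j)
    rw [Function.iterate_succ_apply, ← ih (measurable_feynmanKac K hF hg)]
    refine Eq.trans (lintegral_congr fun u => ?_)
      (lintegral_mul_chainState_succ hφ hψ.1 (n₀ + n) hprod (hF.mul hg))
    rw [Fin.prod_univ_castSucc, mul_assoc]
    rfl

lemma lintegral_prod_burnInPoints (hφ : IsUpdateFunction φ K) (hψ : IsGeneratorFunction ψ ν)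
    {F : X → ℝ≥0∞} (hF : Measurable F) (n₀ n : ℕ) :
    ∫⁻ u, ∏ j, F (burnInPoints φ ψ n₀ (n + 1) u j) =
      ∫⁻ x, F x * (feynmanKac K F)^[n] 1 x ∂iterMeasure K ν n₀ := by
  rw [← lintegral_prod_mul_burnInPoints hφ hψ hF n₀ n measurable_one]
  simp only [Pi.one_apply, mul_one]

end Chain

section VisitFrequency

variable {X : Type*} {n : ℕ}

/-- The proportion of the points `z₁, …, zₙ` lying in `A`, i.e. the empirical measure of `A`
(with value `0` for `n = 0`). -/
def visitFrequency (z : Fin n → X) (A : Set X) : ℝ :=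
  (1 / (n : ℝ)) * ∑ j, A.indicator (fun _ => (1 : ℝ)) (z j)

lemma natCast_mul_visitFrequency (z : Fin n → X) (A : Set X) :
    n * visitFrequency z A = ∑ j, A.indicator (fun _ => (1 : ℝ)) (z j) := by
  rcases Nat.eq_zero_or_pos n with rfl | hn
  · simp
  · rw [visitFrequency, ← mul_assoc, mul_one_div_cancel (by positivity), one_mul]

@[simp]
lemma visitFrequency_empty (z : Fin n → X) : visitFrequency z ∅ = 0 := by
  simp [visitFrequency]

lemma visitFrequency_mono (z : Fin n → X) {A B : Set X} (hAB : A ⊆ B) :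
    visitFrequency z A ≤ visitFrequency z B :=
  mul_le_mul_of_nonneg_left (Finset.sum_le_sum fun j _ =>
    Set.indicator_le_indicator_of_subset hAB (fun _ => zero_le_one) (z j)) (by positivity)

lemma visitFrequency_nonneg (z : Fin n → X) (A : Set X) : 0 ≤ visitFrequency z A :=
  visitFrequency_empty z ▸ visitFrequency_mono z A.empty_subset

lemma visitFrequency_le_one (z : Fin n → X) (A : Set X) : visitFrequency z A ≤ 1 := by
  refine (visitFrequency_mono z A.subset_univ).trans ?_
  simpa [visitFrequency] using inv_mul_le_one (a := (n : ℝ))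

lemma ofReal_exp_mul_visitFrequency (z : Fin n → X) (A : Set X) (t : ℝ) :
    ENNReal.ofReal (Real.exp (t * (n * visitFrequency z A))) = ∏ j, etilt A t (z j) := by
  rw [natCast_mul_visitFrequency, Finset.mul_sum, Real.exp_sum,
    ENNReal.ofReal_prod_of_nonneg fun j _ => (Real.exp_pos _).le]
  rfl

end VisitFrequency

section Deviation

variable {X : Type*} [MeasurableSpace X] {s : ℕ} {K : Kernel X X} [IsMarkovKernel K]
  {π ν : Measure X} [IsProbabilityMeasure π] [IsProbabilityMeasure ν] {hK : K.Invariant π} {l : ℝ}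
  {φ : X → Cube s → X} {ψ : Cube s → X} {A : Set X}

lemma PoincareBound.lintegral_exp_visitFrequency_le (hl : PoincareBound K π hK l)
    (hrev : K.IsReversible π) (hν : HasL2Density ν π) (hφ : IsUpdateFunction φ K)
    (hψ : IsGeneratorFunction ψ ν) (hA : MeasurableSet A) (t : ℝ) (n₀ : ℕ) {n : ℕ} (hn : 1 ≤ n) :
    ∫⁻ u, ENNReal.ofReal
        (Real.exp (t * (n * visitFrequency (burnInPoints φ ψ n₀ n u) A))) ≤
      ENNReal.ofReal (densityNorm (iterMeasure K ν n₀) π *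
        Real.exp (n * (t * π.real A + varianceFactor l * t ^ 2 / 4))) := by
  obtain ⟨k, rfl⟩ : ∃ k, n = k + 1 := ⟨n - 1, by omega⟩
  have hdens := hν.isL2DensityOf.iterMeasure hrev n₀
  simp only [ofReal_exp_mul_visitFrequency]
  rw [lintegral_prod_burnInPoints hφ hψ (measurable_etilt hA t), hdens.densityNorm_eq,
    hdens.eq_withDensity, Nat.cast_succ]
  exact hl.lintegral_withDensity_etilt_mul_feynmanKac_iterate_le hrev hA _ t k

lemma PoincareBound.volume_le_mul_visitFrequency_sub_le (hl : PoincareBound K π hK l)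
    (hrev : K.IsReversible π) (hν : HasL2Density ν π) (hφ : IsUpdateFunction φ K)
    (hψ : IsGeneratorFunction ψ ν) (hA : MeasurableSet A) (t c : ℝ) (n₀ : ℕ) {n : ℕ}
    (hn : 1 ≤ n) :
    volume {u | c ≤ t * (n * (visitFrequency (burnInPoints φ ψ n₀ n u) A - π.real A))} ≤
      ENNReal.ofReal (densityNorm (iterMeasure K ν n₀) π *
        Real.exp (n * (varianceFactor l * t ^ 2 / 4) - c)) := by
  set M := densityNorm (iterMeasure K ν n₀) π
  set Y : (Fin (n₀ + n) → Cube s) → ℝ≥0∞ := fun u =>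
    ENNReal.ofReal (Real.exp (t * (n * visitFrequency (burnInPoints φ ψ n₀ n u) A)))
  set y : ℝ≥0∞ := ENNReal.ofReal (Real.exp (c + t * (n * π.real A)))
  have hY : Measurable Y := by
    simp only [Y, ofReal_exp_mul_visitFrequency]
    exact Finset.measurable_prod _ fun j _ =>
      (measurable_etilt hA t).comp (measurable_burnInPoints hφ.1 hψ.1 n₀ n j)
  have hy : y ≠ 0 := (ENNReal.ofReal_pos.2 (Real.exp_pos _)).ne'
  have hsub : {u | c ≤ t * (n * (visitFrequency (burnInPoints φ ψ n₀ n u) A - π.real A))} ⊆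
      {u | y ≤ Y u} := fun u (hu : c ≤ t * _) =>
    ENNReal.ofReal_le_ofReal (Real.exp_le_exp.2 (by linarith))
  calc _ ≤ volume {u | y ≤ Y u} := measure_mono hsub
    _ ≤ (∫⁻ u, Y u) / y := meas_ge_le_lintegral_div hY.aemeasurable hy ENNReal.ofReal_ne_top
    _ ≤ ENNReal.ofReal (M * Real.exp (n * (t * π.real A + varianceFactor l * t ^ 2 / 4))) / y :=
      ENNReal.div_le_div_right
        (hl.lintegral_exp_visitFrequency_le hrev hν hφ hψ hA t n₀ hn) _
    _ = _ := by
      rw [← ENNReal.ofReal_div_of_pos (Real.exp_pos _), mul_div_assoc, ← Real.exp_sub]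
      ring_nf

lemma PoincareBound.volume_lt_abs_visitFrequency_sub_le (hl : PoincareBound K π hK l)
    (hrev : K.IsReversible π) (hν : HasL2Density ν π) (hφ : IsUpdateFunction φ K)
    (hψ : IsGeneratorFunction ψ ν) (hA : MeasurableSet A) {ε : ℝ} (hε : 0 ≤ ε) (n₀ : ℕ) {n : ℕ}
    (hn : 1 ≤ n) :
    volume {u | ε < |visitFrequency (burnInPoints φ ψ n₀ n u) A - π.real A|} ≤
      2 * ENNReal.ofReal (densityNorm (iterMeasure K ν n₀) π *
        Real.exp (-(n * ε ^ 2 / varianceFactor l))) := by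
  set R := varianceFactor l
  have hR : 0 < R := zero_lt_one.trans_le (one_le_varianceFactor hl.nonneg hl.lt_one)
  -- `t = 2 ε / R` minimizes the Chernoff exponent `n (R t² / 4 - t ε)`.
  set t := 2 * ε / R with ht
  have ht₀ : 0 ≤ t := by positivity
  have htail : ∀ r : ℝ, r ^ 2 = t ^ 2 →
      volume {u | t * (n * ε) ≤
        r * (n * (visitFrequency (burnInPoints φ ψ n₀ n u) A - π.real A))} ≤
      ENNReal.ofReal (densityNorm (iterMeasure K ν n₀) π * Real.exp (-(n * ε ^ 2 / R))) := by
    intro r hr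
    convert hl.volume_le_mul_visitFrequency_sub_le hrev hν hφ hψ hA r (t * (n * ε)) n₀ hn using 4
    rw [hr, ht]
    field_simp
    ring
  rw [two_mul]
  refine (measure_mono ?_).trans
    ((measure_union_le _ _).trans (add_le_add (htail t rfl) (htail (-t) (neg_sq t))))
  intro u hu
  refine (lt_abs.1 (Set.mem_ofPred_eq ▸ hu)).imp (fun h => ?_) fun h => ?_
  · exact mul_le_mul_of_nonneg_left (mul_le_mul_of_nonneg_left h.le n.cast_nonneg) ht₀
  · rw [Set.mem_ofPred_eq, neg_mul, ← mul_neg, ← mul_neg]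
    exact mul_le_mul_of_nonneg_left (mul_le_mul_of_nonneg_left h.le n.cast_nonneg) ht₀

end Deviation

section DiscrepancyRadius

/-- The radius `ε` at which the Hoeffding factor `exp (-n ε² / R)`, `R = (1 + l) / (1 - l)`, equals
`B⁻²`. -/
def discrepancyRadius (l B : ℝ) (n : ℕ) : ℝ :=
  √(varianceFactor l) * (√(2 * Real.log B) / √(n : ℝ))

lemma discrepancyRadius_nonneg (l B : ℝ) (n : ℕ) : 0 ≤ discrepancyRadius l B n := by
  unfold discrepancyRadius
  positivity

lemma discrepancyRadius_mono (l : ℝ) {B B' : ℝ} (hB : 0 < B) (hBB' : B ≤ B') (n : ℕ) :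
    discrepancyRadius l B n ≤ discrepancyRadius l B' n := by
  unfold discrepancyRadius
  gcongr

lemma exp_neg_mul_discrepancyRadius_sq {l B : ℝ} {n : ℕ} (hl₀ : 0 ≤ l) (hl₁ : l < 1)
    (hB : 1 ≤ B) (hn : 1 ≤ n) :
    Real.exp (-(n * discrepancyRadius l B n ^ 2 / varianceFactor l)) = (B ^ 2)⁻¹ := by
  have hR : 0 < varianceFactor l := zero_lt_one.trans_le (one_le_varianceFactor hl₀ hl₁)
  have hlog : 0 ≤ 2 * Real.log B := mul_nonneg zero_le_two (Real.log_nonneg hB)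
  have hexponent : n * discrepancyRadius l B n ^ 2 / varianceFactor l = 2 * Real.log B := by
    rw [discrepancyRadius, mul_pow, div_pow, Real.sq_sqrt hR.le, Real.sq_sqrt hlog,
      Real.sq_sqrt n.cast_nonneg]
    field_simp
  rw [hexponent, Real.exp_neg, two_mul, Real.exp_add, Real.exp_log (by linarith), sq]

lemma discrepancyRadius_le {l b B : ℝ} {n : ℕ} (hlb : l ≤ b) (hb : b < 1) (hB : 1 ≤ B) :
    discrepancyRadius l B n ≤ 4 * √(Real.log B) / √(n * (1 - b)) := by
  have : 0 < 1 - b := by linarith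
  have hlog : 0 ≤ Real.log B := Real.log_nonneg hB
  have hfour : 4 * √(Real.log B) / √(n * (1 - b)) = √(16 * Real.log B / (n * (1 - b))) := by
    rw [Real.sqrt_div (by positivity), show 16 * Real.log B = 4 ^ 2 * Real.log B by norm_num,
      Real.sqrt_mul (by positivity : (0 : ℝ) ≤ 4 ^ 2) (Real.log B), Real.sqrt_sq zero_le_four]
  have hfactor : varianceFactor l ≤ 2 / (1 - b) := by
    rw [varianceFactor]
    gcongr
    linarith
  rw [discrepancyRadius, hfour, ← Real.sqrt_div (by positivity),
    ← Real.sqrt_mul' _ (by positivity)]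
  refine Real.sqrt_le_sqrt ?_
  calc varianceFactor l * (2 * Real.log B / n) ≤ 2 / (1 - b) * (2 * Real.log B / n) := by gcongr
    _ = 4 * Real.log B / (n * (1 - b)) := by rw [div_mul_div_comm]; ring_nf
    _ ≤ 16 * Real.log B / (n * (1 - b)) := by gcongr; norm_num

lemma one_sub_pow_mul_pow_div_mul_le {l b c : ℝ} {k N n : ℕ} (hl₀ : 0 ≤ l) (hlb : l ≤ b)
    (hb : b < 1) (hn : 1 ≤ n) (hc : 0 ≤ c) :
    (1 - l ^ N) * b ^ k / (n * (1 - l)) * c ≤ 2 * b ^ k * c / (n * (1 - b)) := by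
  have hb₀ : 0 ≤ b := hl₀.trans hlb
  have : 0 < 1 - b := by linarith
  have htwo : 1 - l ^ N ≤ 2 := by linarith [pow_nonneg hl₀ N]
  rw [div_mul_eq_mul_div]
  gcongr

end DiscrepancyRadius

section Driver

variable {X : Type*} [MeasurableSpace X] {s : ℕ} {K : Kernel X X} [IsMarkovKernel K]
  {π ν : Measure X} [IsProbabilityMeasure π] [IsProbabilityMeasure ν] {hK : K.Invariant π} {l : ℝ}
  {φ : X → Cube s → X} {ψ : Cube s → X}

lemma PoincareBound.exists_forall_abs_visitFrequency_sub_le (hl : PoincareBound K π hK l)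
    (hrev : K.IsReversible π) (hν : HasL2Density ν π) (hφ : IsUpdateFunction φ K)
    (hψ : IsGeneratorFunction ψ ν) {Γ : Finset (Set X)} (hΓ : ∀ C ∈ Γ, MeasurableSet C)
    {ε : ℝ} (hε : 0 ≤ ε) (n₀ : ℕ) {n : ℕ} (hn : 1 ≤ n)
    (hsmall : Γ.card * (2 * (densityNorm (iterMeasure K ν n₀) π *
      Real.exp (-(n * ε ^ 2 / varianceFactor l)))) < 1) :
    ∃ u, ∀ C ∈ Γ, |visitFrequency (burnInPoints φ ψ n₀ n u) C - π.real C| ≤ ε := by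
  set bad : Set X → Set (Fin (n₀ + n) → Cube s) := fun C =>
    {u | ε < |visitFrequency (burnInPoints φ ψ n₀ n u) C - π.real C|} with hbad
  have hvolume : volume (⋃ C ∈ Γ, bad C) < volume (Set.univ : Set (Fin (n₀ + n) → Cube s)) := by
    calc volume (⋃ C ∈ Γ, bad C) ≤ ∑ C ∈ Γ, volume (bad C) := measure_biUnion_finset_le _ _
      _ ≤ ∑ _C ∈ Γ, 2 * ENNReal.ofReal (densityNorm (iterMeasure K ν n₀) π *
          Real.exp (-(n * ε ^ 2 / varianceFactor l))) := Finset.sum_le_sum fun C hC =>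
        hl.volume_lt_abs_visitFrequency_sub_le hrev hν hφ hψ (hΓ C hC) hε n₀ hn
      _ = ENNReal.ofReal (Γ.card * (2 * (densityNorm (iterMeasure K ν n₀) π *
          Real.exp (-(n * ε ^ 2 / varianceFactor l))))) := by
        rw [Finset.sum_const, nsmul_eq_mul, ENNReal.ofReal_mul (Nat.cast_nonneg _),
          ENNReal.ofReal_natCast, ENNReal.ofReal_mul zero_le_two, ENNReal.ofReal_ofNat]
      _ < volume Set.univ := by rwa [measure_univ, ENNReal.ofReal_lt_one]
  obtain ⟨u, hu⟩ := (Set.ne_univ_iff_exists_notMem _).1 fun h => hvolume.ne (congrArg volume h)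
  simp only [hbad, Set.mem_iUnion, Set.mem_ofPred_eq, not_exists, not_lt] at hu
  exact ⟨u, hu⟩

lemma sub_one_mul_two_mul_inv_sq_lt_one {m M : ℝ} (hm : 1 ≤ m) (hM : 1 ≤ M) :
    (m - 1) * (2 * (M * ((m ^ 2 * M) ^ 2)⁻¹)) < 1 := by
  have hrewrite : (m - 1) * (2 * (M * ((m ^ 2 * M) ^ 2)⁻¹)) = 2 * (m - 1) / (m ^ 4 * M) := by
    field_simp
  rw [hrewrite, div_lt_one (by positivity)]
  calc 2 * (m - 1) < m ^ 2 := by nlinarith [sq_nonneg (m - 1)]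
    _ ≤ m ^ 4 := pow_le_pow_right₀ hm (by norm_num)
    _ ≤ m ^ 4 * M := le_mul_of_one_le_right (by positivity) hM

lemma PoincareBound.exists_driver (hl : PoincareBound K π hK l)
    (hrev : K.IsReversible π) (hν : HasL2Density ν π) (hφ : IsUpdateFunction φ K)
    (hψ : IsGeneratorFunction ψ ν) {Γ : Finset (Set X)} (hΓ : ∀ C ∈ Γ, MeasurableSet C)
    (hempty : ∅ ∈ Γ) (n₀ : ℕ) {n : ℕ} (hn : 1 ≤ n) :
    ∃ u, ∀ C ∈ Γ, |visitFrequency (burnInPoints φ ψ n₀ n u) C - π.real C| ≤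
      discrepancyRadius l ((Γ.card : ℝ) ^ 2 * densityNorm (iterMeasure K ν n₀) π) n := by
  classical
  set M := densityNorm (iterMeasure K ν n₀) π
  have hM : 1 ≤ M := (hν.isL2DensityOf.iterMeasure hrev n₀).hasL2Density.one_le_densityNorm
  have hcard : 1 ≤ (Γ.card : ℝ) := by exact_mod_cast Finset.card_pos.2 ⟨_, hempty⟩
  set B := (Γ.card : ℝ) ^ 2 * M
  have hB₁ : 1 ≤ B := one_le_mul_of_one_le_of_one_le (one_le_pow₀ hcard) hM
  -- The deviation of `∅` is zero, which saves one set in the union bound; this matters when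
  -- `Γ = {∅}`, where the radius may vanish.
  have hsmall : (Γ.erase ∅).card * (2 * (M *
      Real.exp (-(n * discrepancyRadius l B n ^ 2 / varianceFactor l)))) < 1 := by
    rw [exp_neg_mul_discrepancyRadius_sq hl.nonneg hl.lt_one hB₁ hn,
      Finset.cast_card_erase_of_mem hempty]
    exact sub_one_mul_two_mul_inv_sq_lt_one hcard hM
  obtain ⟨u, hu⟩ := hl.exists_forall_abs_visitFrequency_sub_le hrev hν hφ hψ
    (fun C hC => hΓ C (Finset.mem_of_mem_erase hC)) (discrepancyRadius_nonneg l B n) n₀ hn hsmall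
  refine ⟨u, fun C hC => ?_⟩
  rcases eq_or_ne C ∅ with rfl | hne
  · simpa using discrepancyRadius_nonneg l B n
  · exact hu C (Finset.mem_erase.2 ⟨hne, hC⟩)

end Driver

section Discrepancy

variable {X : Type*} [MeasurableSpace X] {π : Measure X} [IsProbabilityMeasure π]
  {𝒜 : Set (Set X)} {n : ℕ}

lemma IsDeltaCover.abs_visitFrequency_sub_le {δ ε : ℝ} {Γ : Finset (Set X)}
    (hΓ : IsDeltaCover π 𝒜 δ Γ) {z : Fin n → X}
    (hz : ∀ C ∈ Γ, |visitFrequency z C - π.real C| ≤ ε) {A : Set X} (hA : A ∈ 𝒜) :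
    |visitFrequency z A - π.real A| ≤ ε + δ := by
  obtain ⟨C, hC, D, hD, hCA, hAD, hδ⟩ := hΓ.bracket A hA
  rw [measureReal_sdiff (hCA.trans hAD) (hΓ.measurableSet C hC)] at hδ
  have hlower := (abs_le.1 (hz C hC)).1
  have hupper := (abs_le.1 (hz D hD)).2
  have hπCA : π.real C ≤ π.real A := measureReal_mono hCA
  have hπAD : π.real A ≤ π.real D := measureReal_mono hAD
  exact abs_le.2 ⟨by linarith [visitFrequency_mono z hCA], by linarith [visitFrequency_mono z hAD]⟩

lemma IsDeltaCover.starDiscrepancy_le {δ ε : ℝ} {Γ : Finset (Set X)}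
    (hΓ : IsDeltaCover π 𝒜 δ Γ) (hδ : 0 ≤ δ) {z : Fin n → X}
    (hz : ∀ C ∈ Γ, |visitFrequency z C - π.real C| ≤ ε) : starDiscrepancy 𝒜 π z ≤ ε + δ :=
  Real.iSup_le (fun A => hΓ.abs_visitFrequency_sub_le hz A.2)
    (add_nonneg ((abs_nonneg _).trans (hz ∅ hΓ.empty_mem)) hδ)

lemma abs_visitFrequency_sub_le_starDiscrepancy (z : Fin n → X) {A : Set X} (hA : A ∈ 𝒜) :
    |visitFrequency z A - π.real A| ≤ starDiscrepancy 𝒜 π z := by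
  refine le_ciSup (f := fun A : 𝒜 => |visitFrequency z A - π.real (A : Set X)|) ⟨1, ?_⟩ ⟨A, hA⟩
  rintro _ ⟨A, rfl⟩
  exact abs_sub_le_of_nonneg_of_le (visitFrequency_nonneg z A) (visitFrequency_le_one z A)
    measureReal_nonneg measureReal_le_one

end Discrepancy

section PullBackDiscrepancy

variable {X : Type*} [MeasurableSpace X] {s : ℕ} {K : Kernel X X}
  {π ν : Measure X} {φ : X → Cube s → X} {ψ : Cube s → X}

lemma localDiscrepancyBurnIn_eq (π : Measure X) [IsProbabilityMeasure ν]
    (hφ : IsUpdateFunction φ K) (hψ : IsGeneratorFunction ψ ν) {A : Set X}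
    (hA : MeasurableSet A) (n₀ : ℕ) {n : ℕ} (hn : 1 ≤ n) (u : Fin (n₀ + n) → Cube s) :
    localDiscrepancyBurnIn φ ψ n₀ n A u =
      (visitFrequency (burnInPoints φ ψ n₀ n u) A - π.real A) -
        (1 / (n : ℝ)) * ∑ j ∈ Finset.range n,
          ((iterMeasure K ν (n₀ + j)).real A - π.real A) := by
  have hvolume : ∀ j : Fin n, volume.real (pullBack φ ψ (n₀ + j.val) A) =
      (iterMeasure K ν (n₀ + j.val)).real A := fun j =>
    congrArg ENNReal.toReal (volume_pullBack hφ hψ _ hA)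
  have hindicator : ∀ j : Fin n, (pullBack φ ψ (n₀ + j.val) A).indicator (fun _ => (1 : ℝ))
      (initialSegment u (Fin.natAdd n₀ j)) =
      A.indicator (fun _ => (1 : ℝ)) (burnInPoints φ ψ n₀ n u j) := fun j => rfl
  simp only [localDiscrepancyBurnIn, visitFrequency, Finset.sum_range, hindicator, hvolume,
    Finset.sum_sub_distrib, Finset.sum_const, Finset.card_range, nsmul_eq_mul]
  field_simp
  ring

variable [IsMarkovKernel K] [IsProbabilityMeasure π] [IsProbabilityMeasure ν]
  {hK : K.Invariant π} {l : ℝ}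

lemma PoincareBound.abs_localDiscrepancyBurnIn_le (hl : PoincareBound K π hK l)
    (hrev : K.IsReversible π) (hν : HasL2Density ν π) (hφ : IsUpdateFunction φ K)
    (hψ : IsGeneratorFunction ψ ν) {A : Set X} (hA : MeasurableSet A) (n₀ : ℕ) {n : ℕ}
    (hn : 1 ≤ n) (u : Fin (n₀ + n) → Cube s) :
    |localDiscrepancyBurnIn φ ψ n₀ n A u| ≤
      |visitFrequency (burnInPoints φ ψ n₀ n u) A - π.real A| +
        (1 - l ^ n) * opNorm0 K π hK ^ n₀ / (n * (1 - l)) * densitySubOneNorm ν π := by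
  have hl' : 1 - l ≠ 0 := (sub_pos.2 hl.lt_one).ne'
  have hgeom : ∑ j ∈ Finset.range n, l ^ j = (1 - l ^ n) / (1 - l) := by
    rw [eq_div_iff hl', mul_comm, mul_neg_geom_sum]
  have hbias := hl.abs_sum_iterMeasure_sub_le hrev hν hA n₀ n
  rw [localDiscrepancyBurnIn_eq π hφ hψ hA n₀ hn u]
  refine (abs_sub _ _).trans (add_le_add_right ?_ _)
  rw [abs_mul, abs_of_nonneg (by positivity)]
  refine (mul_le_mul_of_nonneg_left hbias (by positivity)).trans_eq ?_
  rw [hgeom]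
  field_simp

lemma PoincareBound.pullBackDiscrepancyBurnIn_le (hl : PoincareBound K π hK l)
    (hrev : K.IsReversible π) (hν : HasL2Density ν π) (hφ : IsUpdateFunction φ K)
    (hψ : IsGeneratorFunction ψ ν) {𝒜 : Set (Set X)} (h𝒜 : ∀ A ∈ 𝒜, MeasurableSet A) (n₀ : ℕ)
    {n : ℕ} (hn : 1 ≤ n) (u : Fin (n₀ + n) → Cube s) :
    pullBackDiscrepancyBurnIn 𝒜 φ ψ n₀ n u ≤
      starDiscrepancy 𝒜 π (burnInPoints φ ψ n₀ n u) +
        (1 - l ^ n) * opNorm0 K π hK ^ n₀ / (n * (1 - l)) * densitySubOneNorm ν π := by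
  have hl' : 0 < 1 - l := sub_pos.2 hl.lt_one
  have hln : 0 ≤ 1 - l ^ n := sub_nonneg.2 (pow_le_one₀ hl.nonneg hl.lt_one.le)
  have hnorm : 0 ≤ opNorm0 K π hK := norm_nonneg (markovOp0 K π hK)
  have hdens : 0 ≤ densitySubOneNorm ν π := ENNReal.toReal_nonneg
  have hstar : 0 ≤ starDiscrepancy 𝒜 π (burnInPoints φ ψ n₀ n u) :=
    Real.iSup_nonneg fun _ => abs_nonneg _
  refine Real.iSup_le (fun A => ?_) (by positivity)
  exact (hl.abs_localDiscrepancyBurnIn_le hrev hν hφ hψ (h𝒜 A A.2) n₀ hn u).trans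
    (add_le_add_left (abs_visitFrequency_sub_le_starDiscrepancy _ A.2) _)

end PullBackDiscrepancy

end MCQMC

end

theorem mainTheorem6_general {X : Type*} [MeasurableSpace X] {s : ℕ}
    (K : ProbabilityTheory.Kernel X X) [ProbabilityTheory.IsMarkovKernel K]
    (π ν : MeasureTheory.Measure X)
    [MeasureTheory.IsProbabilityMeasure π] [MeasureTheory.IsProbabilityMeasure ν]
    (hrev : K.IsReversible π)
    (hν : MCQMC.HasL2Density ν π)
    (hvb : MCQMC.VarianceBounding K π hrev.invariant)
    (𝒜 : Set (Set X)) (h𝒜 : ∀ A ∈ 𝒜, MeasurableSet A)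
    (δ : ℝ) (hδ : 0 ≤ δ) (Γ : Finset (Set X)) (hΓ : MCQMC.IsDeltaCover π 𝒜 δ Γ)
    (φ : X → MCQMC.Cube s → X) (hφ : MCQMC.IsUpdateFunction φ K)
    (ψ : MCQMC.Cube s → X) (hψ : MCQMC.IsGeneratorFunction ψ ν)
    (n₀ n : ℕ) (hn : 1 ≤ n)
    (Λ Λ₀ β : ℝ) (hΛ : Λ = MCQMC.specSup K π hrev.invariant) (hΛ₀ : Λ₀ = max 0 Λ)
    (hβ : β = MCQMC.opNorm0 K π hrev.invariant) :
    MCQMC.HasL2Density (MCQMC.iterMeasure K ν n₀) π ∧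
    ∃ u : Fin (n₀ + n) → MCQMC.Cube s,
      MCQMC.starDiscrepancy 𝒜 π (MCQMC.burnInPoints φ ψ n₀ n u) ≤
          √((1 + Λ₀) / (1 - Λ₀)) *
            (√(2 * Real.log ((Γ.card : ℝ) ^ 2 *
              MCQMC.densityNorm (MCQMC.iterMeasure K ν n₀) π)) / √(n : ℝ)) + δ ∧
      (MCQMC.HasAbsSpectralGap K π hrev.invariant →
        Λ₀ ≤ β ∧ |Λ| ≤ β ∧
        MCQMC.pullBackDiscrepancyBurnIn 𝒜 φ ψ n₀ n u ≤
          √((1 + Λ₀) / (1 - Λ₀)) *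
            (√(2 * Real.log ((Γ.card : ℝ) ^ 2 *
              (1 + β ^ n₀ * MCQMC.densitySubOneNorm ν π))) / √(n : ℝ)) +
          (1 - Λ₀ ^ n) * β ^ n₀ / ((n : ℝ) * (1 - Λ₀)) * MCQMC.densitySubOneNorm ν π + δ ∧
        MCQMC.pullBackDiscrepancyBurnIn 𝒜 φ ψ n₀ n u ≤
          4 * √(Real.log ((Γ.card : ℝ) ^ 2 *
              (1 + β ^ n₀ * MCQMC.densitySubOneNorm ν π))) / √((n : ℝ) * (1 - β)) +
          2 * β ^ n₀ * MCQMC.densitySubOneNorm ν π / ((n : ℝ) * (1 - β)) + δ) := by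
  subst hΛ hΛ₀ hβ
  have hl := hvb.poincareBound hrev
  have hdens := hν.isL2DensityOf.iterMeasure hrev n₀
  refine ⟨hdens.hasL2Density, ?_⟩
  obtain ⟨u, hu⟩ := hl.exists_driver hrev hν hφ hψ hΓ.measurableSet hΓ.empty_mem n₀ hn
  have hstar := hΓ.starDiscrepancy_le hδ hu
  refine ⟨u, hstar, fun hgap => ?_⟩
  have hspec := MCQMC.abs_specSup_le_opNorm0 hrev
  have hle := max_le ((abs_nonneg _).trans hspec) ((le_abs_self _).trans hspec)
  have hcard : 1 ≤ (Γ.card : ℝ) := by exact_mod_cast Finset.card_pos.2 ⟨_, hΓ.empty_mem⟩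
  have hB := one_le_mul_of_one_le_of_one_le (one_le_pow₀ hcard (n := 2))
    hdens.hasL2Density.one_le_densityNorm
  have hBle := mul_le_mul_of_nonneg_left (MCQMC.densityNorm_iterMeasure_le hrev hν n₀)
    (sq_nonneg (Γ.card : ℝ))
  have hmono := MCQMC.discrepancyRadius_mono (max 0 (MCQMC.specSup K π hrev.invariant))
    (zero_lt_one.trans_le hB) hBle n
  have hpull := hl.pullBackDiscrepancyBurnIn_le hrev hν hφ hψ h𝒜 n₀ hn u
  have hfirst := hpull.trans (add_le_add_left (hstar.trans (add_le_add_left hmono δ)) _)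
  rw [add_right_comm] at hfirst
  refine ⟨hle, hspec, hfirst, hfirst.trans ?_⟩
  gcongr
  · exact MCQMC.discrepancyRadius_le hle hgap (hB.trans hBle)
  · exact MCQMC.one_sub_pow_mul_pow_div_mul_le hl.nonneg hle hgap hn ENNReal.toReal_nonneg

theorem mainTheorem6 {d s : ℕ} (G : Set (EuclideanSpace ℝ (Fin d)))
    (K : ProbabilityTheory.Kernel G G) [ProbabilityTheory.IsMarkovKernel K]
    (π ν : MeasureTheory.Measure G)
    [MeasureTheory.IsProbabilityMeasure π] [MeasureTheory.IsProbabilityMeasure ν]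
    (hrev : K.IsReversible π)
    (hν : MCQMC.HasL2Density ν π)
    (hvb : MCQMC.VarianceBounding K π hrev.invariant)
    (𝒜 : Set (Set G)) (h𝒜 : ∀ A ∈ 𝒜, MeasurableSet A)
    (Γ : ℝ → Finset (Set G)) (hΓ : ∀ δ : ℝ, 0 < δ → MCQMC.IsDeltaCover π 𝒜 δ (Γ δ))
    (φ : G → MCQMC.Cube s → G) (hφ : MCQMC.IsUpdateFunction φ K)
    (ψ : MCQMC.Cube s → G) (hψ : MCQMC.IsGeneratorFunction ψ ν)
    (n₀ n : ℕ) (hn : 1 ≤ n) (δ : ℝ) (hδ : 0 < δ)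
    (Λ Λ₀ β : ℝ) (hΛ : Λ = MCQMC.specSup K π hrev.invariant) (hΛ₀ : Λ₀ = max 0 Λ)
    (hβ : β = MCQMC.opNorm0 K π hrev.invariant) :
    MCQMC.HasL2Density (MCQMC.iterMeasure K ν n₀) π ∧
    ∃ u : Fin (n₀ + n) → MCQMC.Cube s,
      MCQMC.starDiscrepancy 𝒜 π (MCQMC.burnInPoints φ ψ n₀ n u) ≤
          √((1 + Λ₀) / (1 - Λ₀)) *
            (√(2 * Real.log (((Γ δ).card : ℝ) ^ 2 *
              MCQMC.densityNorm (MCQMC.iterMeasure K ν n₀) π)) / √(n : ℝ)) + δ ∧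
      (MCQMC.HasAbsSpectralGap K π hrev.invariant →
        Λ₀ ≤ β ∧ |Λ| ≤ β ∧
        MCQMC.pullBackDiscrepancyBurnIn 𝒜 φ ψ n₀ n u ≤
          √((1 + Λ₀) / (1 - Λ₀)) *
            (√(2 * Real.log (((Γ δ).card : ℝ) ^ 2 *
              (1 + β ^ n₀ * MCQMC.densitySubOneNorm ν π))) / √(n : ℝ)) +
          (1 - Λ₀ ^ n) * β ^ n₀ / ((n : ℝ) * (1 - Λ₀)) * MCQMC.densitySubOneNorm ν π + δ ∧
        MCQMC.pullBackDiscrepancyBurnIn 𝒜 φ ψ n₀ n u ≤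
          4 * √(Real.log (((Γ δ).card : ℝ) ^ 2 *
              (1 + β ^ n₀ * MCQMC.densitySubOneNorm ν π))) / √((n : ℝ) * (1 - β)) +
          2 * β ^ n₀ * MCQMC.densitySubOneNorm ν π / ((n : ℝ) * (1 - β)) + δ) :=
  mainTheorem6_general K π ν hrev hν hvb 𝒜 h𝒜 δ hδ.le (Γ δ) (hΓ δ hδ) φ hφ ψ hψ n₀ n hn Λ Λ₀ β
    hΛ hΛ₀ hβ
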